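/- **Setting.** Fix a finite field $\mathbb F_q$, integers $N,K\ge 1$ (numbers of files and of active users) and a memory ratio $\gamma\in[0,1]$; let $r=\min(N,K)$ and $[x]^+=\max(0,x)$. For a file length $B$, the files $F_1,\dots,F_N\in\mathbb F_q^B$ have i.i.d. uniform symbols. *1-LinP placement:* user $k\in\{1,\dots,K\}$ caches $Z_k=(E_{k,n}^{T}F_n)_{n=1}^{N}$, where the matrices $E_{k,n}\in\mathbb F_q^{B\times\lfloor\gamma B\rfloor}$ are independent and uniformly distributed, and independent of the files. *Delivery:* for a demand matrix $D=(d_{k,n})\in\mathbb F_q^{K\times N}$, user $k$ wants $B_k=\sum_{n} d_{k,n}F_n$. Given the placement matrices $E=(E_{k,n})$ and $D$, the server sends a signal $X\in\mathbb F_q^{L}$ that is a function of the files, and user $k$ forms an estimate $\hat B_k$ as a function of $(Z_k,X)$. For $\varepsilon>0$ let $R^\star_\varepsilon(E)$ be the least $R\in[0,N]$ for which there is an integer $L\le RB$ such that, for every $D$, such encoding and decoding functions exist with $\Pr(\hat B_k\ne B_k)\le\varepsilon$ for every $k$ (the probability is over the files, for the given $E$ and $D$). The expected worst-case load is $$\Delta^{(\mathfrak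 L_1)}(\gamma)=\lim_{\varepsilon\downarrow 0}\ \limsup_{B\to\infty}\ \mathbb E_E\,R^\star_\varepsilon(E).$$ **Theorem (converse for 1-LinP).** One has $$\Delta^{(\mathfrak L_1)}(\gamma)\ \ge\ \Delta_1=\sum_{t=1}^{r}[1-t\gamma]^+ .$$ If moreover $K\ge 3$ and $N\ge 2$, then $$\Delta^{(\mathfrak L_1)}(\gamma)\ \ge\ \Delta_2= r(1-\gamma)-\frac{\tau_{K-1}-\tau_K}{K-1}-\sum_{j=3}^{r}(\rho_j-\gamma)-\sum_{j=3}^{K}\frac{\min(\gamma+\tau_{j-2},\,1-\gamma)}{K-1},$$ where $\tau_s=[1-s(1-\gamma)]^+$ and $\rho_s=\min(s\gamma,1)$. -/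

import Mathlib

open scoped Classical Matrix

namespace CodedCaching

noncomputable section

/-- The files `F 0, …, F (N - 1)`, each a vector of `B` symbols of `𝔽`. -/
abbrev Library (𝔽 : Type*) (N B : ℕ) : Type _ := Fin N → Fin B → 𝔽

/-- The column vector in `𝔽 ^ (N B)` that concatenates all files; position `(b, n)` holds the
`b`-th symbol of the `n`-th file. -/
def Library.concat {𝔽 : Type*} {N B : ℕ} (F : Library 𝔽 N B) : Fin B × Fin N → 𝔽 :=
  fun i => F i.2 i.1

/-- The cache content `Z = Eᵀ F` of a user with placement matrix `E`. The index type `C` of the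
columns of `E` indexes the cached symbols. -/
def cacheContent {𝔽 : Type*} [Field 𝔽] {N B : ℕ} {C : Type*}
    (E : Matrix (Fin B × Fin N) C 𝔽) (F : Library 𝔽 N B) : C → 𝔽 :=
  Eᵀ *ᵥ F.concat

/-- The scalar linear function `∑ n, d n • F n` of the files demanded by a user with demand
vector `d`. -/
def demanded {𝔽 : Type*} [Field 𝔽] {N B : ℕ} (d : Fin N → 𝔽) (F : Library 𝔽 N B) : Fin B → 𝔽 :=
  ∑ n, d n • F n

/-- A delivery scheme with `L` transmitted symbols: the server maps the demand matrix (whose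
`k`-th row is the demand of user `k`) and the files to a signal `X`; user `k` estimates its
demanded vector from the demand matrix, its own cache content and `X`. -/
structure DeliveryScheme (𝔽 : Type*) (K N B : ℕ) (C : Type*) (L : ℕ) where
  encode : Matrix (Fin K) (Fin N) 𝔽 → Library 𝔽 N B → (Fin L → 𝔽)
  decode : Matrix (Fin K) (Fin N) 𝔽 → Fin K → (C → 𝔽) → (Fin L → 𝔽) → (Fin B → 𝔽)

/-- The probability that user `k` fails to recover its demanded linear function, for given
placement matrices `E` and demand matrix `D`, when all symbols of all files are i.i.d. uniform. -/
def DeliveryScheme.errorProb {𝔽 : Type*} [Field 𝔽] [Fintype 𝔽] {K N B : ℕ} {C : Type*} {L : ℕ}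
    (S : DeliveryScheme 𝔽 K N B C L) (E : Fin K → Matrix (Fin B × Fin N) C 𝔽)
    (D : Matrix (Fin K) (Fin N) 𝔽) (k : Fin K) : ℝ :=
  ((PMF.uniformOfFintype (Library 𝔽 N B)).toOuterMeasure
    {F | S.decode D k (cacheContent (E k) F) (S.encode D F) ≠ demanded (D k) F}).toReal

/-- The minimal worst-case load for given placement matrices `E`, with error tolerance `ε`: the
least `R ∈ [0, N]` such that at most `R B` transmitted symbols suffice for every demand matrix.
The scheme may depend on `E`. -/
def minLoad {𝔽 : Type*} [Field 𝔽] [Fintype 𝔽] {K N B : ℕ} {C : Type*} (ε : ℝ)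
    (E : Fin K → Matrix (Fin B × Fin N) C 𝔽) : ℝ :=
  sInf {R : ℝ | R ∈ Set.Icc (0 : ℝ) N ∧ ∃ L : ℕ, (L : ℝ) ≤ R * B ∧
    ∃ S : DeliveryScheme 𝔽 K N B C L, ∀ D k, S.errorProb E D k ≤ ε}

/-- The expectation of the minimal worst-case load when the placement matrices of the `K` users
are i.i.d. with law `P` (the prefetching scheme). -/
def meanLoad {𝔽 : Type*} [Field 𝔽] [Fintype 𝔽] (K : ℕ) {N B : ℕ} {C : Type*} [Fintype C]
    (ε : ℝ) (P : PMF (Matrix (Fin B × Fin N) C 𝔽)) : ℝ :=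
  ∑ E : Fin K → Matrix (Fin B × Fin N) C 𝔽, (∏ k, (P (E k)).toReal) * minLoad ε E

/-- The expected worst-case load of a prefetching scheme `P` (given for every file length `B`) when
serving `K` users, with vanishing error probability: the limit as `ε ↓ 0` (a supremum, since the
load is antitone in `ε`) of the upper limit as `B → ∞` of the mean load at tolerance `ε`. It is at
most the upper limit of the mean loads with error tolerance `0`. -/
def expectedLoad {𝔽 : Type*} [Field 𝔽] [Fintype 𝔽] (K : ℕ) {N : ℕ} {C : ℕ → Type*}
    [∀ B, Fintype (C B)] (P : (B : ℕ) → PMF (Matrix (Fin B × Fin N) (C B) 𝔽)) : ℝ :=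
  ⨆ ε : Set.Ioi (0 : ℝ), Filter.limsup (fun B : ℕ => meanLoad K (ε : ℝ) (P B)) Filter.atTop

/-- The 1-LinP prefetching scheme with memory ratio `γ`: every cached symbol is a linear combination
of symbols of one file, `⌊γ B⌋` symbols being cached of each file. The `n`-th diagonal block is the
matrix of the `n`-th file, and all entries of all diagonal blocks are i.i.d. uniform in `𝔽`. -/
def oneLinP (𝔽 : Type*) [Field 𝔽] [Fintype 𝔽] (N : ℕ) (γ : ℝ) (B : ℕ) :
    PMF (Matrix (Fin B × Fin N) (Fin ⌊γ * B⌋₊ × Fin N) 𝔽) :=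
  (PMF.uniformOfFintype (Fin N → Matrix (Fin B) (Fin ⌊γ * B⌋₊) 𝔽)).map Matrix.blockDiagonal

/-- `τ s = [1 - s (1 - γ)]⁺`. -/
def tau (γ : ℝ) (s : ℕ) : ℝ := max 0 (1 - s * (1 - γ))

/-- `ρ s = min (s γ, 1)`. -/
def rho (γ : ℝ) (s : ℕ) : ℝ := min (s * γ) 1

/-- `Δ₁ = ∑_{t=1}^{r} [1 - t γ]⁺` with `r = min (N, K)`. -/
def delta₁ (N K : ℕ) (γ : ℝ) : ℝ :=
  ∑ t ∈ Finset.Icc 1 (min N K), max 0 (1 - t * γ)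

/-- `Δ₂`, with `r = min (N, K)`; used for `3 ≤ K` and `2 ≤ N` only. -/
def delta₂ (N K : ℕ) (γ : ℝ) : ℝ :=
  (min N K : ℕ) * (1 - γ) - (tau γ (K - 1) - tau γ K) / ((K : ℝ) - 1)
    - ∑ j ∈ Finset.Icc 3 (min N K), (rho γ j - γ)
    - ∑ j ∈ Finset.Icc 3 K, min (γ + tau γ (j - 2)) (1 - γ) / ((K : ℝ) - 1)

end

end CodedCaching

namespace CodedCaching

/-! The converse is an entropy argument for a fixed placement; for Δ₂ it is then averaged over the
placement. At error tolerance 1/(2K) the union bound leaves at least half of all libraries on which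
every user decodes correctly (`goodSet`). All counting takes place there, and the factor 2 costs at
most one symbol, which vanishes after division by B. A single tolerance suffices because the load is
a supremum over ε (`le_expectedLoad_oneLinP`).

For Δ₁, distinct users demand distinct files as long as possible. The signal, the parts of file n
cached by users 0, …, n, and the files that nobody demands together determine the library, since the
files can be decoded one after the other. File n costs at most min(B, (n+1)m) symbols of side
information, with m = ⌊γB⌋, so counting gives the bound for every placement
(`sum_sub_one_le_signalLength`).

For Δ₂ and γ ≤ 1/3, already Δ₂ ≤ Δ₁. For γ ≥ 1/3 every ρ_j with j ≥ 3 equals 1, and Δ₂ becomes a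
bound involving two files only. User 0 demands file 0 and the other n = K - 1 users demand file 1.
Let a(P) be the entropy, in symbols, of file 0 given the signal, all other files, and file 0 modulo
the subspace P. Submodularity of entropy reads a(P) + a(Q) ≤ a(P ⊓ Q) + a(P ⊔ Q). Since user 0
decodes, a(P) ≤ dim (P + W₀)/W₀, where W₀ is the kernel of its cache of file 0. Since every other
user recovers file 1, its kernel W has a(W) ≥ 2B - 2m - 1 - L. Summing over these users and merging
the kernels one at a time bounds n(2B - 2m - 1 - L) by dimensions of kernels and of their sums
(`mul_sub_overlapBound_le`). For uniform placements a first-moment count with Jensen's inequality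
bounds the mean dimension of a kernel by B - m + 1 (`expect_finrank_cacheKernel_le`) and the mean
codimension of a sum of s kernels by τ_s B + 1 (`expect_codim_iSup_le`, `tau_mul_le`). -/

/-! ### Entropy of equivalence classes in a finite set -/

/-- The sum over `x ∈ G` of the logarithm of the size of the class of `x` in `G`. Up to the sign
and the normalisation this is the conditional entropy of a uniform element of `G` given its
class. -/
noncomputable def logClassSum {Ω : Type*} (G : Finset Ω) (s : Setoid Ω) : ℝ :=
  ∑ x ∈ G, Real.log (G.filter (fun y => s x y)).card

theorem card_class_pos {Ω : Type*} {G : Finset Ω} (s : Setoid Ω) {x : Ω} (hx : x ∈ G) :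
    (0 : ℝ) < (G.filter (fun y => s x y)).card := by
  have : x ∈ G.filter (fun y => s x y) := by simp [hx]
  exact_mod_cast Finset.card_pos.2 ⟨x, this⟩

theorem card_class_congr {Ω : Type*} (G : Finset Ω) (s : Setoid Ω) {x y : Ω} (h : s x y) :
    G.filter (fun z => s x z) = G.filter (fun z => s y z) := by
  refine Finset.filter_congr fun z _ => ⟨fun h' => s.trans (s.symm h) h', fun h' => s.trans h h'⟩

/-- The exponential form of submodularity. Write the numerator as a count of pairs (y, z) with y in
the `s`-class and z in the `t`-class of x. For a fixed pair all such x lie in one `u`-class, so they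
contribute at most the reciprocal of the size of the common `w`-class of y and z; summing over z
then gives at most 1 for each y. -/
theorem sum_class_div_le {Ω : Type*} (G : Finset Ω) {s t u w : Setoid Ω} (hu : s ⊓ t ≤ u)
    (hs : s ≤ w) (ht : t ≤ w) :
    ∑ x ∈ G, ((G.filter (fun y => s x y)).card * (G.filter (fun y => t x y)).card : ℝ) /
      ((G.filter (fun y => u x y)).card * (G.filter (fun y => w x y)).card) ≤ G.card := by
  have key : ∀ y ∈ G, ∀ z ∈ G, ∑ x ∈ G, (if s x y then (1 : ℝ) else 0) * (if t x z then 1 else 0) /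
      ((G.filter (fun y => u x y)).card * (G.filter (fun y => w x y)).card) ≤
      (if w y z then 1 else 0) / (G.filter (fun z => w y z)).card := by
    intro y hy z hz
    set Q := G.filter (fun x => s x y ∧ t x z) with hQ
    have h1 : ∑ x ∈ G, (if s x y then (1 : ℝ) else 0) * (if t x z then 1 else 0) /
      ((G.filter (fun y => u x y)).card * (G.filter (fun y => w x y)).card) =
        ∑ x ∈ Q, 1 / (((G.filter (fun y => u x y)).card : ℝ) *
          (G.filter (fun y => w x y)).card) := by
      rw [hQ, Finset.sum_filter]
      refine Finset.sum_congr rfl fun x _ => ?_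
      by_cases h : s x y <;> by_cases h' : t x z <;> simp [h, h']
    rw [h1]
    rcases Q.eq_empty_or_nonempty with h0 | ⟨x₀, hx₀⟩
    · rw [h0]; simp only [Finset.sum_empty]; positivity
    have hmem : ∀ x ∈ Q, x ∈ G ∧ s x y ∧ t x z := fun x hx => by simpa [hQ] using hx
    obtain ⟨_, h2, h3⟩ := hmem x₀ hx₀
    have hyz : w y z := w.trans (w.symm (hs h2)) (ht h3)
    rw [if_pos hyz]
    have hQpos : (0 : ℝ) < Q.card := by exact_mod_cast Finset.card_pos.2 ⟨x₀, hx₀⟩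
    have hwpos := card_class_pos w hy
    calc _ ≤ ∑ x ∈ Q, 1 / ((Q.card : ℝ) * (G.filter (fun z => w y z)).card) := by
          refine Finset.sum_le_sum fun x hx => ?_
          obtain ⟨_, h4, h5⟩ := hmem x hx
          rw [card_class_congr G w (hs h4)]
          refine one_div_le_one_div_of_le (by positivity) ?_
          refine mul_le_mul_of_nonneg_right ?_ hwpos.le
          refine Nat.cast_le.2 (Finset.card_le_card fun x' hx' => ?_)
          obtain ⟨h6, h7, h8⟩ := hmem x' hx'
          simp only [Finset.mem_filter]
          exact ⟨h6, hu ⟨s.trans h4 (s.symm h7), t.trans h5 (t.symm h8)⟩⟩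
      _ = 1 / (G.filter (fun z => w y z)).card := by
          rw [Finset.sum_const, nsmul_eq_mul]; field_simp
  calc _ = ∑ x ∈ G, ∑ y ∈ G, ∑ z ∈ G, (if s x y then (1 : ℝ) else 0) * (if t x z then 1 else 0) /
        ((G.filter (fun y => u x y)).card * (G.filter (fun y => w x y)).card) := by
        refine Finset.sum_congr rfl fun x _ => ?_
        simp_rw [← Finset.sum_div]
        rw [← Finset.sum_mul_sum]
        simp
    _ = ∑ y ∈ G, ∑ z ∈ G, ∑ x ∈ G, (if s x y then (1 : ℝ) else 0) * (if t x z then 1 else 0) /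
        ((G.filter (fun y => u x y)).card * (G.filter (fun y => w x y)).card) := by
        rw [Finset.sum_comm]
        exact Finset.sum_congr rfl fun y _ => Finset.sum_comm
    _ ≤ ∑ y ∈ G, ∑ z ∈ G, (if w y z then 1 else 0) / ((G.filter (fun z => w y z)).card : ℝ) :=
        Finset.sum_le_sum fun y hy => Finset.sum_le_sum fun z hz => key y hy z hz
    _ = ∑ y ∈ G, 1 := by
        refine Finset.sum_congr rfl fun y hy => ?_
        rw [← Finset.sum_div]
        have := card_class_pos w hy
        rw [div_eq_one_iff_eq this.ne']
        simp
    _ = _ := by simp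

/-- Submodularity of entropy. -/
theorem logClassSum_add_le {Ω : Type*} (G : Finset Ω) {s t u w : Setoid Ω} (hu : s ⊓ t ≤ u)
    (hs : s ≤ w) (ht : t ≤ w) :
    logClassSum G s + logClassSum G t ≤ logClassSum G u + logClassSum G w := by
  unfold logClassSum
  rw [← sub_nonpos, ← Finset.sum_add_distrib, ← Finset.sum_add_distrib, ← Finset.sum_sub_distrib]
  calc _ ≤ ∑ x ∈ G, (((G.filter (fun y => s x y)).card * (G.filter (fun y => t x y)).card : ℝ) /
      ((G.filter (fun y => u x y)).card * (G.filter (fun y => w x y)).card) - 1) := by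
        refine Finset.sum_le_sum fun x hx => ?_
        have h1 := card_class_pos s hx
        have h2 := card_class_pos t hx
        have h3 := card_class_pos u hx
        have h4 := card_class_pos w hx
        rw [← Real.log_mul h1.ne' h2.ne', ← Real.log_mul h3.ne' h4.ne',
          ← Real.log_div (by positivity) (by positivity)]
        -- The bound log t ≤ t - 1 reduces submodularity to the ratio sum of `sum_class_div_le`.
        exact Real.log_le_sub_one_of_pos (by positivity)
    _ ≤ 0 := by
        rw [Finset.sum_sub_distrib]
        have := sum_class_div_le G hu hs ht
        simpa using this

theorem logClassSum_le {Ω : Type*} (G : Finset Ω) (s : Setoid Ω) {M : ℝ}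
    (h : ∀ x ∈ G, ((G.filter (fun y => s x y)).card : ℝ) ≤ M) :
    logClassSum G s ≤ G.card * Real.log M := by
  unfold logClassSum
  calc _ ≤ ∑ _x ∈ G, Real.log M :=
        Finset.sum_le_sum fun x hx => Real.log_le_log (card_class_pos s hx) (h x hx)
    _ = _ := by simp

/-- If `f` determines the class, there are at most |α| classes, so the class carries entropy at most
log |α|. The number of classes enters as the sum of reciprocal class sizes, and log t ≤ t - 1
replaces Jensen's inequality. -/
theorem le_logClassSum {Ω α : Type*} [Fintype α] (G : Finset Ω) (hG : G.Nonempty) (s : Setoid Ω)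
    (f : Ω → α) (h : ∀ x ∈ G, ∀ y ∈ G, f x = f y → s x y) :
    G.card * (Real.log G.card - Real.log (Fintype.card α)) ≤ logClassSum G s := by
  obtain ⟨x₀, hx₀⟩ := hG
  have hGpos : (0 : ℝ) < G.card := by exact_mod_cast Finset.card_pos.2 ⟨x₀, hx₀⟩
  have hM : (0 : ℝ) < Fintype.card α := by exact_mod_cast Fintype.card_pos_iff.2 ⟨f x₀⟩
  have h1 : ∑ x ∈ G, (1 : ℝ) / (G.filter (fun y => s x y)).card ≤ Fintype.card α := by
    calc _ ≤ ∑ x ∈ G, (1 : ℝ) / (G.filter (fun y => f y = f x)).card := by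
          refine Finset.sum_le_sum fun x hx => one_div_le_one_div_of_le ?_ ?_
          · exact_mod_cast Finset.card_pos.2 ⟨x, by simp [hx]⟩
          · refine Nat.cast_le.2 (Finset.card_le_card fun y hy => ?_)
            simp only [Finset.mem_filter] at hy ⊢
            exact ⟨hy.1, h x hx y hy.1 hy.2.symm⟩
      _ = ∑ a : α, ∑ x ∈ G.filter (fun x => f x = a),
            (1 : ℝ) / (G.filter (fun y => f y = f x)).card :=
          (Finset.sum_fiberwise G f _).symm
      _ ≤ ∑ _a : α, 1 := by
          refine Finset.sum_le_sum fun a _ => ?_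
          rw [Finset.sum_congr rfl (g := fun _ => (1 : ℝ) / (G.filter (fun y => f y = a)).card)]
          · rw [Finset.sum_const, nsmul_eq_mul, mul_one_div]
            exact div_self_le_one _
          · intro x hx
            simp only [Finset.mem_filter] at hx
            rw [hx.2]
      _ = _ := by simp
  unfold logClassSum
  rw [← Real.log_div hGpos.ne' hM.ne']
  calc _ = ∑ _x ∈ G, Real.log (G.card / Fintype.card α) := by simp
    _ ≤ ∑ x ∈ G, (Real.log (G.filter (fun y => s x y)).card - 1 +
          (G.card / Fintype.card α) * (1 / (G.filter (fun y => s x y)).card)) := by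
        refine Finset.sum_le_sum fun x hx => ?_
        have h2 := card_class_pos s hx
        have h3 : (0 : ℝ) < G.card / Fintype.card α := by positivity
        have := Real.log_le_sub_one_of_pos (div_pos h3 h2)
        rw [Real.log_div h3.ne' h2.ne'] at this
        rw [mul_one_div]
        linarith
    _ ≤ _ := by
        rw [Finset.sum_add_distrib, Finset.sum_sub_distrib, ← Finset.mul_sum]
        have : (G.card / Fintype.card α : ℝ) *
            ∑ x ∈ G, (1 : ℝ) / (G.filter (fun y => s x y)).card ≤ G.card := by
          calc _ ≤ (G.card / Fintype.card α : ℝ) * Fintype.card α := by gcongr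
            _ = _ := by field_simp
        simp only [Finset.sum_const, nsmul_eq_mul, mul_one]
        linarith

/-! ### Uniform random matrices and first-moment bounds -/

theorem card_fiber_mul_card {A C : Type*} [AddGroup A] [AddGroup C] [Fintype A] [Fintype C]
    (f : A →+ C) (hf : Function.Surjective f) (c : C) :
    (Finset.univ.filter (fun a => f a = c)).card * Fintype.card C = Fintype.card A := by
  have h : ∀ c', (Finset.univ.filter (fun a => f a = c')).card =
      (Finset.univ.filter (fun a => f a = c)).card := fun c' =>
    AddMonoidHom.card_fiber_eq_of_mem_range f (hf c') (hf c)
  calc _ = ∑ c' : C, (Finset.univ.filter (fun a => f a = c')).card := by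
        rw [Finset.sum_congr rfl fun c' _ => h c', Finset.sum_const, smul_eq_mul,
          Finset.card_univ, mul_comm]
    _ = Fintype.card A := by
        rw [← Finset.card_univ]
        exact (Finset.card_eq_sum_card_fiberwise fun a _ => Finset.mem_univ (f a)).symm

/-- The placement matrices of all users and all files, each with `B` rows and `m` columns. -/
abbrev Placement (𝔽 : Type*) (K N B m : ℕ) : Type _ := Fin K → Fin N → Matrix (Fin B) (Fin m) 𝔽

theorem exists_dotProduct_eq_one {𝔽 : Type*} [Field 𝔽] {m : ℕ} {u : Fin m → 𝔽} (hu : u ≠ 0) :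
    ∃ c : Fin m → 𝔽, c ⬝ᵥ u = 1 := by
  obtain ⟨j, hj⟩ := Function.ne_iff.1 hu
  exact ⟨Pi.single j (u j)⁻¹, by rw [single_dotProduct]; exact inv_mul_cancel₀ hj⟩

/-- Uniform matrices of distinct users, applied to fixed nonzero vectors, give independent uniform
vectors. Rank-one matrices show that the evaluation map is surjective, so all its fibres have the
same size. -/
theorem card_placement_mulVec_eq {𝔽 : Type*} [Field 𝔽] [Fintype 𝔽] {K N B m : ℕ} {ι : Type*}
    [Fintype ι] {σ : ι → Fin K} (hσ : Function.Injective σ) (n : Fin N) {u : ι → Fin m → 𝔽}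
    (hu : ∀ i, u i ≠ 0) (y : ι → Fin B → 𝔽) :
    (Finset.univ.filter (fun e : Placement 𝔽 K N B m => (fun i => e (σ i) n *ᵥ u i) = y)).card *
      (Fintype.card 𝔽 ^ B) ^ Fintype.card ι = Fintype.card (Placement 𝔽 K N B m) := by
  let f : Placement 𝔽 K N B m →+ (ι → Fin B → 𝔽) :=
    { toFun := fun e i => e (σ i) n *ᵥ u i
      map_zero' := by ext; simp
      map_add' := by intro a b; ext; simp [Matrix.add_mulVec] }
  have hf : Function.Surjective f := by
    intro y
    choose c hc using fun i => exists_dotProduct_eq_one (hu i)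
    refine ⟨fun k _ => Function.extend σ (fun i => Matrix.vecMulVec (y i) (c i)) 0 k, ?_⟩
    funext i
    change (Function.extend σ (fun i => Matrix.vecMulVec (y i) (c i)) 0 (σ i)) *ᵥ u i = y i
    rw [hσ.extend_apply, Matrix.vecMulVec_mulVec, hc]
    simp
  have h := card_fiber_mul_card f hf y
  rw [show Fintype.card (ι → Fin B → 𝔽) = (Fintype.card 𝔽 ^ B) ^ Fintype.card ι by simp] at h
  convert h
  rfl

theorem card_placement_transpose_mulVec_eq {𝔽 : Type*} [Field 𝔽] [Fintype 𝔽] {K N B m : ℕ}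
    (k : Fin K) (n : Fin N) {x : Fin B → 𝔽} (hx : x ≠ 0) (z : Fin m → 𝔽) :
    (Finset.univ.filter (fun e : Placement 𝔽 K N B m => (e k n)ᵀ *ᵥ x = z)).card *
      Fintype.card 𝔽 ^ m = Fintype.card (Placement 𝔽 K N B m) := by
  let f : Placement 𝔽 K N B m →+ (Fin m → 𝔽) :=
    { toFun := fun e => (e k n)ᵀ *ᵥ x
      map_zero' := by ext; simp
      map_add' := by intro a b; ext; simp [Matrix.add_mulVec] }
  have hf : Function.Surjective f := by
    intro z
    obtain ⟨c, hc⟩ := exists_dotProduct_eq_one hx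
    refine ⟨fun _ _ => Matrix.vecMulVec c z, ?_⟩
    change (Matrix.vecMulVec c z)ᵀ *ᵥ x = z
    rw [Matrix.transpose_vecMulVec, Matrix.vecMulVec_mulVec, hc]
    simp
  have h := card_fiber_mul_card f hf z
  rw [show Fintype.card (Fin m → 𝔽) = Fintype.card 𝔽 ^ m by simp] at h
  convert h
  rfl

/-- The Jensen inequality for the logarithm: a bound on the mean of `q ^ w` bounds the mean of
`w`. -/
theorem expect_le_of_pow_le {Ω : Type*} [Fintype Ω] [Nonempty Ω] {q : ℕ} (hq : 2 ≤ q)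
    (w c : Ω → ℕ) (h : ∀ e, q ^ w e ≤ c e) (x : ℝ)
    (hc : ((∑ e, c e : ℕ) : ℝ) ≤ 2 * (q : ℝ) ^ x * Fintype.card Ω) :
    Finset.univ.expect (fun e => (w e : ℝ)) ≤ x + 1 := by
  have hq0 : (0 : ℝ) < q := by positivity
  have hq2 : (2 : ℝ) ≤ q := by exact_mod_cast hq
  have hlog : 0 < Real.log q := Real.log_pos (by linarith)
  have hM : 0 < 2 * (q : ℝ) ^ x := by positivity
  have hΩ : (0 : ℝ) < Fintype.card Ω := by exact_mod_cast Fintype.card_pos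
  -- The tangent to the logarithm at 2q^x. The factor 2 leaves room for the zero vector in the
  -- counts below and costs only 1 in the exponent, because 2 ≤ q.
  have h1 : ∀ e, (w e : ℝ) * Real.log q ≤
      Real.log (2 * (q : ℝ) ^ x) + (c e / (2 * (q : ℝ) ^ x) - 1) := by
    intro e
    have h2 : (0 : ℝ) < (q : ℝ) ^ w e := by positivity
    have h3 := Real.log_le_sub_one_of_pos (div_pos h2 hM)
    rw [Real.log_div h2.ne' hM.ne', Real.log_pow] at h3
    have h4 : (q : ℝ) ^ w e / (2 * (q : ℝ) ^ x) ≤ c e / (2 * (q : ℝ) ^ x) := by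
      gcongr; exact_mod_cast h e
    linarith
  have h2 : (∑ e, (w e : ℝ)) * Real.log q ≤ Fintype.card Ω * Real.log (2 * (q : ℝ) ^ x) := by
    calc _ ≤ ∑ e, (Real.log (2 * (q : ℝ) ^ x) + (c e / (2 * (q : ℝ) ^ x) - 1)) := by
          rw [Finset.sum_mul]; exact Finset.sum_le_sum fun e _ => h1 e
      _ = Fintype.card Ω * Real.log (2 * (q : ℝ) ^ x) +
          (((∑ e, c e : ℕ) : ℝ) / (2 * (q : ℝ) ^ x) - Fintype.card Ω) := by
          simp [Finset.sum_add_distrib, Finset.sum_sub_distrib, Finset.sum_div]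
      _ ≤ _ := by
          have : ((∑ e, c e : ℕ) : ℝ) / (2 * (q : ℝ) ^ x) ≤ Fintype.card Ω := by
            rw [div_le_iff₀ hM]; linarith
          linarith
  have h3 : Real.log (2 * (q : ℝ) ^ x) ≤ (x + 1) * Real.log q := by
    rw [Real.log_mul (by norm_num) (by positivity), Real.log_rpow hq0]
    have := Real.log_le_log (by norm_num) hq2
    linarith
  rw [Fintype.expect_eq_sum_div_card, div_le_iff₀ hΩ]
  refine le_of_mul_le_mul_right (h2.trans ?_) hlog
  calc _ ≤ Fintype.card Ω * ((x + 1) * Real.log q) := by gcongr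
    _ = _ := by ring

theorem two_le_card (𝔽 : Type*) [Field 𝔽] [Fintype 𝔽] : 2 ≤ Fintype.card 𝔽 :=
  Fintype.one_lt_card

/-! ### Cache kernels and their mean dimensions -/

/-- The vectors of file `n` that are invisible in the cache of user `k`. -/
noncomputable def cacheKernel {𝔽 : Type*} [Field 𝔽] {K N B m : ℕ} (e : Placement 𝔽 K N B m)
    (n : Fin N) (k : Fin K) : Submodule 𝔽 (Fin B → 𝔽) :=
  LinearMap.ker (e k n)ᵀ.mulVecLin

theorem mem_cacheKernel {𝔽 : Type*} [Field 𝔽] {K N B m : ℕ} {e : Placement 𝔽 K N B m}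
    {n : Fin N} {k : Fin K} {x : Fin B → 𝔽} :
    x ∈ cacheKernel e n k ↔ (e k n)ᵀ *ᵥ x = 0 := by
  rw [cacheKernel, LinearMap.mem_ker, Matrix.mulVecLin_apply]

theorem le_finrank_cacheKernel {𝔽 : Type*} [Field 𝔽] {K N B m : ℕ} (e : Placement 𝔽 K N B m)
    (n : Fin N) (k : Fin K) : B ≤ Module.finrank 𝔽 (cacheKernel e n k) + m := by
  have h1 := LinearMap.finrank_range_add_finrank_ker (e k n)ᵀ.mulVecLin
  have h2 := Submodule.finrank_le (LinearMap.range (e k n)ᵀ.mulVecLin)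
  simp only [Module.finrank_fintype_fun_eq_card, Fintype.card_fin] at h1 h2
  unfold cacheKernel
  omega

/-- A nonzero vector lies in the kernel with probability q^(-m), and the zero vector always does.
The mean kernel size is thus at most 1 + q^(B-m) ≤ 2q^(B-m), where the last step needs m ≤ B. -/
theorem expect_finrank_cacheKernel_le {𝔽 : Type*} [Field 𝔽] [Fintype 𝔽] {K N B m : ℕ}
    (hm : m ≤ B) (n : Fin N) (k : Fin K) :
    Finset.univ.expect (fun e : Placement 𝔽 K N B m =>
      (Module.finrank 𝔽 (cacheKernel e n k) : ℝ)) ≤ (B - m : ℝ) + 1 := by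
  set q := Fintype.card 𝔽 with hq
  have hq2 : 2 ≤ q := two_le_card 𝔽
  have hq0 : (0 : ℝ) < q := by positivity
  refine expect_le_of_pow_le hq2 (fun e => Module.finrank 𝔽 (cacheKernel e n k))
    (fun e : Placement 𝔽 K N B m =>
      (Finset.univ.filter (fun x : Fin B → 𝔽 => (e k n)ᵀ *ᵥ x = 0)).card) ?_ _ ?_
  · intro e
    rw [hq, ← Module.card_eq_pow_finrank (K := 𝔽) (V := cacheKernel e n k), Fintype.card_subtype]
    refine le_of_eq ?_
    congr 1
    ext x
    simp [mem_cacheKernel]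
  · have h1 : ∑ e : Placement 𝔽 K N B m,
        (Finset.univ.filter (fun x : Fin B → 𝔽 => (e k n)ᵀ *ᵥ x = 0)).card =
        ∑ x : Fin B → 𝔽, (Finset.univ.filter
          (fun e : Placement 𝔽 K N B m => (e k n)ᵀ *ᵥ x = 0)).card := by
      simp_rw [Finset.card_filter]
      exact Finset.sum_comm
    rw [h1, Nat.cast_sum, ← Finset.add_sum_erase _ _ (Finset.mem_univ (0 : Fin B → 𝔽))]
    have h2 : ∀ x ∈ Finset.univ.erase (0 : Fin B → 𝔽), ((Finset.univ.filter
          (fun e : Placement 𝔽 K N B m => (e k n)ᵀ *ᵥ x = 0)).card : ℝ) =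
          Fintype.card (Placement 𝔽 K N B m) / (q : ℝ) ^ m := by
      intro x hx
      rw [eq_div_iff (by positivity)]
      exact_mod_cast card_placement_transpose_mulVec_eq k n (Finset.ne_of_mem_erase hx) 0
    rw [Finset.sum_congr rfl h2, Finset.sum_const, nsmul_eq_mul]
    have h3 : (1 : ℝ) ≤ (q : ℝ) ^ ((B : ℝ) - m) :=
      Real.one_le_rpow (by exact_mod_cast (by omega : 1 ≤ q)) (by simpa using hm)
    have h4 : (((Finset.univ.erase (0 : Fin B → 𝔽)).card : ℕ) : ℝ) ≤ (q : ℝ) ^ B := by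
      have : (Finset.univ.erase (0 : Fin B → 𝔽)).card ≤ q ^ B :=
        (Finset.card_le_univ _).trans (by simp [hq])
      exact_mod_cast this
    have h5 : (q : ℝ) ^ ((B : ℝ) - m) = (q : ℝ) ^ B / (q : ℝ) ^ m := by
      rw [Real.rpow_sub hq0, Real.rpow_natCast, Real.rpow_natCast]
    have h6 : ((Finset.univ.filter
          (fun e : Placement 𝔽 K N B m => (e k n)ᵀ *ᵥ (0 : Fin B → 𝔽) = 0)).card : ℝ) ≤
          Fintype.card (Placement 𝔽 K N B m) := by
      exact_mod_cast Finset.card_le_univ _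
    calc _ ≤ (Fintype.card (Placement 𝔽 K N B m) : ℝ) +
          (q : ℝ) ^ B * (Fintype.card (Placement 𝔽 K N B m) / (q : ℝ) ^ m) := by gcongr
      _ = (1 + (q : ℝ) ^ ((B : ℝ) - m)) * Fintype.card (Placement 𝔽 K N B m) := by
          rw [h5]; ring
      _ ≤ _ := by gcongr; linarith

/-- The annihilator of the kernel of a transpose is the column space of the matrix. -/
theorem exists_mulVec_of_mem_dualAnnihilator {𝔽 : Type*} [Field 𝔽] {K N B m : ℕ}
    {e : Placement 𝔽 K N B m} {n : Fin N} {k : Fin K} {y : Fin B → 𝔽}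
    (h : dotProductEquiv 𝔽 (Fin B) y ∈ (cacheKernel e n k).dualAnnihilator) :
    ∃ u, e k n *ᵥ u = y := by
  rw [cacheKernel, ← LinearMap.range_dualMap_eq_dualAnnihilator_ker] at h
  obtain ⟨ψ, hψ⟩ := h
  refine ⟨(dotProductEquiv 𝔽 (Fin m)).symm ψ, ?_⟩
  apply (dotProductEquiv 𝔽 (Fin B)).injective
  rw [← hψ]
  ext i
  obtain ⟨u, rfl⟩ := (dotProductEquiv 𝔽 (Fin m)).surjective ψ
  simp [Matrix.mulVec, Matrix.row, dotProduct_comm]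

/-- By duality the codimension is the dimension of the intersection of the s column spaces. A
nonzero y lies in all of them with probability at most q^(sm) q^(-sB), by a union bound over the
coefficient vectors. Summing over y gives at most 1 + q^(sm-(s-1)B). -/
theorem expect_codim_iSup_le {𝔽 : Type*} [Field 𝔽] [Fintype 𝔽] {K N B m : ℕ} {ι : Type*}
    [Fintype ι] {σ : ι → Fin K} (hσ : Function.Injective σ) (n : Fin N) :
    Finset.univ.expect (fun e : Placement 𝔽 K N B m =>
      (B : ℝ) - Module.finrank 𝔽 (⨆ i, cacheKernel e n (σ i) : Submodule 𝔽 (Fin B → 𝔽))) ≤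
      max 0 (Fintype.card ι * m - (Fintype.card ι - 1) * B : ℝ) + 1 := by
  set q := Fintype.card 𝔽 with hq
  have hq2 : 2 ≤ q := two_le_card 𝔽
  have hq0 : (0 : ℝ) < q := by positivity
  set U : Placement 𝔽 K N B m → Submodule 𝔽 (Fin B → 𝔽) := fun e => ⨆ i, cacheKernel e n (σ i)
  have hann : ∀ e, (B : ℝ) - Module.finrank 𝔽 (U e) =
      (Module.finrank 𝔽 (U e).dualAnnihilator : ℝ) := by
    intro e
    have := Subspace.finrank_add_finrank_dualAnnihilator_eq (U e)
    simp only [Module.finrank_fintype_fun_eq_card, Fintype.card_fin] at this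
    have : (Module.finrank 𝔽 (U e) : ℝ) + Module.finrank 𝔽 (U e).dualAnnihilator = B := by
      exact_mod_cast this
    linarith
  rw [Finset.expect_congr rfl fun e _ => hann e]
  refine expect_le_of_pow_le hq2 (fun e => Module.finrank 𝔽 (U e).dualAnnihilator)
    (fun e : Placement 𝔽 K N B m =>
      (Finset.univ.filter (fun y : Fin B → 𝔽 => ∀ i, ∃ u, e (σ i) n *ᵥ u = y)).card) ?_ _ ?_
  · intro e
    have : Finite (Module.Dual 𝔽 (Fin B → 𝔽)) :=
      Finite.of_equiv _ (dotProductEquiv 𝔽 (Fin B)).toEquiv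
    have : Fintype (U e).dualAnnihilator := Fintype.ofFinite _
    rw [hq, ← Module.card_eq_pow_finrank (K := 𝔽) (V := (U e).dualAnnihilator),
      ← Fintype.card_subtype]
    refine Fintype.card_le_of_injective (fun φ => ⟨(dotProductEquiv 𝔽 (Fin B)).symm φ.1, ?_⟩) ?_
    · intro i
      apply exists_mulVec_of_mem_dualAnnihilator
      rw [LinearEquiv.apply_symm_apply]
      exact Submodule.dualAnnihilator_anti (le_iSup (fun i => cacheKernel e n (σ i)) i) φ.2
    · intro φ φ' h
      apply Subtype.ext
      simpa using h
  · have h1 : ∑ e : Placement 𝔽 K N B m,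
        (Finset.univ.filter (fun y : Fin B → 𝔽 => ∀ i, ∃ u, e (σ i) n *ᵥ u = y)).card =
        ∑ y : Fin B → 𝔽, (Finset.univ.filter
          (fun e : Placement 𝔽 K N B m => ∀ i, ∃ u, e (σ i) n *ᵥ u = y)).card := by
      simp_rw [Finset.card_filter]
      exact Finset.sum_comm
    rw [h1, Nat.cast_sum, ← Finset.add_sum_erase _ _ (Finset.mem_univ (0 : Fin B → 𝔽))]
    set T := Fintype.card (Placement 𝔽 K N B m) with hT
    have h2 : ∀ y ∈ Finset.univ.erase (0 : Fin B → 𝔽), ((Finset.univ.filter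
          (fun e : Placement 𝔽 K N B m => ∀ i, ∃ u, e (σ i) n *ᵥ u = y)).card : ℝ) ≤
          ((q : ℝ) ^ m) ^ Fintype.card ι * (T / ((q : ℝ) ^ B) ^ Fintype.card ι) := by
      intro y hy
      have hy0 := Finset.ne_of_mem_erase hy
      have hsub : (Finset.univ.filter
          (fun e : Placement 𝔽 K N B m => ∀ i, ∃ u, e (σ i) n *ᵥ u = y)) ⊆
          Finset.univ.biUnion (fun u : ι → Fin m → 𝔽 => Finset.univ.filter
            (fun e : Placement 𝔽 K N B m => (fun i => e (σ i) n *ᵥ u i) = fun _ => y)) := by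
        intro e he
        simp only [Finset.mem_filter, Finset.mem_univ, true_and, Finset.mem_biUnion] at he ⊢
        choose u hu using he
        exact ⟨u, funext hu⟩
      have h3 : ∀ u : ι → Fin m → 𝔽, ((Finset.univ.filter
            (fun e : Placement 𝔽 K N B m => (fun i => e (σ i) n *ᵥ u i) = fun _ => y)).card : ℝ) ≤
            T / ((q : ℝ) ^ B) ^ Fintype.card ι := by
        intro u
        by_cases hu : ∀ i, u i ≠ 0
        · rw [le_div_iff₀ (by positivity)]
          exact_mod_cast (card_placement_mulVec_eq hσ n hu (fun _ => y)).le
        · push Not at hu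
          obtain ⟨i, hi⟩ := hu
          rw [Finset.filter_false_of_mem]
          · simp only [Finset.card_empty, Nat.cast_zero]; positivity
          · intro e _ he
            have := congrFun he i
            rw [hi, Matrix.mulVec_zero] at this
            exact hy0 this.symm
      calc _ ≤ ((∑ u : ι → Fin m → 𝔽, (Finset.univ.filter (fun e : Placement 𝔽 K N B m =>
              (fun i => e (σ i) n *ᵥ u i) = fun _ => y)).card : ℕ) : ℝ) := by
            exact_mod_cast (Finset.card_le_card hsub).trans Finset.card_biUnion_le
        _ ≤ ∑ u : ι → Fin m → 𝔽, T / ((q : ℝ) ^ B) ^ Fintype.card ι := by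
            rw [Nat.cast_sum]
            exact Finset.sum_le_sum fun u _ => h3 u
        _ = _ := by
            rw [Finset.sum_const, nsmul_eq_mul, Finset.card_univ]
            simp [hq]
    have h4 : (((Finset.univ.erase (0 : Fin B → 𝔽)).card : ℕ) : ℝ) ≤ (q : ℝ) ^ B := by
      have : (Finset.univ.erase (0 : Fin B → 𝔽)).card ≤ q ^ B :=
        (Finset.card_le_univ _).trans (by simp [hq])
      exact_mod_cast this
    have h6 : ((Finset.univ.filter (fun e : Placement 𝔽 K N B m =>
        ∀ i, ∃ u, e (σ i) n *ᵥ u = (0 : Fin B → 𝔽))).card : ℝ) ≤ T := by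
      exact_mod_cast Finset.card_le_univ _
    set x : ℝ := Fintype.card ι * m - (Fintype.card ι - 1) * B with hx
    have h5 : (q : ℝ) ^ x =
        (q : ℝ) ^ B * (((q : ℝ) ^ m) ^ Fintype.card ι / ((q : ℝ) ^ B) ^ Fintype.card ι) := by
      rw [show x = (B : ℝ) + ((m * Fintype.card ι : ℕ) - (B * Fintype.card ι : ℕ)) by
        rw [hx]; push_cast; ring]
      rw [Real.rpow_add hq0, Real.rpow_sub hq0, Real.rpow_natCast, Real.rpow_natCast,
        Real.rpow_natCast, pow_mul, pow_mul]
    have hq1 : (1 : ℝ) ≤ q := by exact_mod_cast (by omega : 1 ≤ q)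
    have h7 : (1 : ℝ) ≤ (q : ℝ) ^ max 0 x := Real.one_le_rpow hq1 (le_max_left _ _)
    have h8 : (q : ℝ) ^ x ≤ (q : ℝ) ^ max 0 x :=
      Real.rpow_le_rpow_of_exponent_le hq1 (le_max_right _ _)
    calc _ ≤ (T : ℝ) + (q : ℝ) ^ B *
          (((q : ℝ) ^ m) ^ Fintype.card ι * (T / ((q : ℝ) ^ B) ^ Fintype.card ι)) := by
            refine add_le_add h6 ((Finset.sum_le_sum h2).trans ?_)
            rw [Finset.sum_const, nsmul_eq_mul]
            gcongr
      _ = (1 + (q : ℝ) ^ x) * T := by rw [h5]; ring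
      _ ≤ _ := by gcongr; linarith

/-! ### Libraries that every user decodes correctly -/

theorem cacheContent_blockDiagonal {𝔽 : Type*} [Field 𝔽] {N B m : ℕ}
    (a : Fin N → Matrix (Fin B) (Fin m) 𝔽) (F : Library 𝔽 N B) (i : Fin m × Fin N) :
    cacheContent (Matrix.blockDiagonal a) F i = ((a i.2)ᵀ *ᵥ F i.2) i.1 := by
  simp [cacheContent, Matrix.mulVec, dotProduct, Matrix.blockDiagonal_apply, Library.concat,
    Fintype.sum_prod_type]

/-- The libraries for which every user recovers its demand. -/
noncomputable def DeliveryScheme.goodSet {𝔽 : Type*} [Field 𝔽] [Fintype 𝔽] {K N B : ℕ} {C : Type*}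
    {L : ℕ} (S : DeliveryScheme 𝔽 K N B C L) (E : Fin K → Matrix (Fin B × Fin N) C 𝔽)
    (D : Matrix (Fin K) (Fin N) 𝔽) : Finset (Library 𝔽 N B) :=
  Finset.univ.filter fun F =>
    ∀ k, S.decode D k (cacheContent (E k) F) (S.encode D F) = demanded (D k) F

theorem DeliveryScheme.card_le_two_mul_card_goodSet {𝔽 : Type*} [Field 𝔽] [Fintype 𝔽]
    {K N B : ℕ} {C : Type*} {L : ℕ} (hK : 1 ≤ K) (S : DeliveryScheme 𝔽 K N B C L)
    (E : Fin K → Matrix (Fin B × Fin N) C 𝔽) (D : Matrix (Fin K) (Fin N) 𝔽)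
    (h : ∀ k, S.errorProb E D k ≤ 1 / (2 * K)) :
    (Fintype.card (Library 𝔽 N B) : ℝ) ≤ 2 * (S.goodSet E D).card := by
  set T := Fintype.card (Library 𝔽 N B) with hT
  have hTpos : (0 : ℝ) < T := by exact_mod_cast Fintype.card_pos
  have hK0 : (0 : ℝ) < K := by exact_mod_cast hK
  set bad : Fin K → Finset (Library 𝔽 N B) := fun k => Finset.univ.filter fun F =>
    S.decode D k (cacheContent (E k) F) (S.encode D F) ≠ demanded (D k) F with hbad
  have h1 : ∀ k, ((bad k).card : ℝ) ≤ T / (2 * K) := by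
    intro k
    have h2 := h k
    rw [DeliveryScheme.errorProb, PMF.toOuterMeasure_uniformOfFintype_apply, ENNReal.toReal_div,
      ENNReal.toReal_natCast, ENNReal.toReal_natCast, div_le_iff₀ hTpos] at h2
    have h3 : (bad k).card = Fintype.card
      ({F | S.decode D k (cacheContent (E k) F) (S.encode D F) ≠ demanded (D k) F} : Set _) := by
      rw [hbad, ← Set.toFinset_card]
      congr 1
      ext F
      simp
    rw [h3]
    calc _ ≤ _ := h2
      _ = _ := by ring
  have hcover : (Finset.univ : Finset (Library 𝔽 N B)) ⊆
      S.goodSet E D ∪ Finset.univ.biUnion bad := by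
    intro F _
    by_cases hF : F ∈ S.goodSet E D
    · exact Finset.mem_union_left _ hF
    · simp only [DeliveryScheme.goodSet, Finset.mem_filter, Finset.mem_univ, true_and,
        not_forall] at hF
      obtain ⟨k, hk⟩ := hF
      refine Finset.mem_union_right _ (Finset.mem_biUnion.2 ⟨k, Finset.mem_univ _, ?_⟩)
      simpa [hbad] using hk
  have h4 : (T : ℝ) ≤ (S.goodSet E D).card + ∑ k, ((bad k).card : ℝ) := by
    have h5 := (Finset.card_le_card hcover).trans (Finset.card_union_le _ _)
    have h6 : T ≤ (S.goodSet E D).card + ∑ k, (bad k).card :=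
      h5.trans (Nat.add_le_add_left Finset.card_biUnion_le _)
    exact_mod_cast h6
  have h7 : ∑ k, ((bad k).card : ℝ) ≤ T / 2 := by
    calc _ ≤ ∑ _k : Fin K, (T : ℝ) / (2 * K) := Finset.sum_le_sum fun k _ => h1 k
      _ = _ := by simp; field_simp
  linarith

/-- Two correctly decoded libraries that look the same to user `k` have the same value of the
linear function demanded by user `k`. -/
theorem DeliveryScheme.demanded_eq {𝔽 : Type*} [Field 𝔽] [Fintype 𝔽] {K N B m L : ℕ}
    {S : DeliveryScheme 𝔽 K N B (Fin m × Fin N) L} {e : Placement 𝔽 K N B m}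
    {D : Matrix (Fin K) (Fin N) 𝔽} {F F' : Library 𝔽 N B}
    (hF : F ∈ S.goodSet (fun k => Matrix.blockDiagonal (e k)) D)
    (hF' : F' ∈ S.goodSet (fun k => Matrix.blockDiagonal (e k)) D) (k : Fin K)
    (hX : S.encode D F = S.encode D F') (h : ∀ n, F n - F' n ∈ cacheKernel e n k) :
    demanded (D k) F = demanded (D k) F' := by
  simp only [DeliveryScheme.goodSet, Finset.mem_filter, Finset.mem_univ, true_and] at hF hF'
  have hc : cacheContent (Matrix.blockDiagonal (e k)) F =
      cacheContent (Matrix.blockDiagonal (e k)) F' := by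
    funext i
    have := h i.2
    rw [mem_cacheKernel, Matrix.mulVec_sub, sub_eq_zero] at this
    rw [cacheContent_blockDiagonal, cacheContent_blockDiagonal, this]
  rw [← hF k, ← hF' k, hc, hX]

theorem demanded_single {𝔽 : Type*} [Field 𝔽] {N B : ℕ} (n : Fin N) (F : Library 𝔽 N B) :
    demanded (Pi.single n 1) F = F n := by
  unfold demanded
  rw [Finset.sum_eq_single n]
  · simp
  · intro n' _ hn
    simp [hn]
  · simp

/-! ### From single placements to the expected load -/

section Load

variable {𝔽 : Type*} [Field 𝔽] [Fintype 𝔽] {K N B : ℕ} {C : Type*}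

/-- Sending the whole library works without error, so the infimum in `minLoad` is over a nonempty
set and is not a default value. -/
theorem mem_loads {ε : ℝ} (hε : 0 < ε) (E : Fin K → Matrix (Fin B × Fin N) C 𝔽) :
    (N : ℝ) ∈ {R : ℝ | R ∈ Set.Icc (0 : ℝ) N ∧ ∃ L : ℕ, (L : ℝ) ≤ R * B ∧
      ∃ S : DeliveryScheme 𝔽 K N B C L, ∀ D k, S.errorProb E D k ≤ ε} := by
  refine ⟨⟨by positivity, le_rfl⟩, N * B, by push_cast; rfl,
    ⟨fun _ F i => F (finProdFinEquiv.symm i).1 (finProdFinEquiv.symm i).2,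
      fun D k _ X => demanded (D k) fun n b => X (finProdFinEquiv (n, b))⟩, fun D k => ?_⟩
  simp [DeliveryScheme.errorProb, hε.le]

theorem minLoad_nonneg (ε : ℝ) (E : Fin K → Matrix (Fin B × Fin N) C 𝔽) : 0 ≤ minLoad ε E :=
  Real.sInf_nonneg fun _ h => h.1.1

theorem minLoad_le {ε : ℝ} (hε : 0 < ε) (E : Fin K → Matrix (Fin B × Fin N) C 𝔽) :
    minLoad ε E ≤ N :=
  csInf_le ⟨0, fun _ h => h.1.1⟩ (mem_loads hε E)

theorem div_le_minLoad {ε : ℝ} (hε : 0 < ε) (hB : 0 < B)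
    (E : Fin K → Matrix (Fin B × Fin N) C 𝔽) {x : ℝ}
    (h : ∀ (L : ℕ) (S : DeliveryScheme 𝔽 K N B C L), (∀ D k, S.errorProb E D k ≤ ε) → x ≤ L) :
    x / B ≤ minLoad ε E := by
  have hB' : (0 : ℝ) < B := by exact_mod_cast hB
  refine le_csInf ⟨_, mem_loads hε E⟩ ?_
  rintro R ⟨_, L, hL, S, hS⟩
  rw [div_le_iff₀ hB']
  exact (h L S hS).trans hL

end Load

theorem toReal_map_uniformOfFintype {A M : Type*} [Fintype A] [Nonempty A] (f : A → M) (x : M) :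
    (((PMF.uniformOfFintype A).map f) x).toReal =
      ∑ a : A, if x = f a then ((Fintype.card A : ℝ))⁻¹ else 0 := by
  rw [PMF.map_apply, tsum_fintype, ENNReal.toReal_sum]
  · refine Finset.sum_congr rfl fun a _ => ?_
    split_ifs <;> simp
  · intro a _
    split_ifs <;> simp

theorem sum_prod_map_uniformOfFintype {A M : Type*} [Fintype A] [Nonempty A] {_ : Fintype M}
    (K : ℕ) (f : A → M) (φ : (Fin K → M) → ℝ) :
    ∑ E : Fin K → M, (∏ k, (((PMF.uniformOfFintype A).map f) (E k)).toReal) * φ E =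
      Finset.univ.expect (fun e : Fin K → A => φ fun k => f (e k)) := by
  have h1 : ∀ E : Fin K → M, (∏ k, (((PMF.uniformOfFintype A).map f) (E k)).toReal) * φ E =
      ∑ e : Fin K → A, if E = (fun k => f (e k)) then
        ((Fintype.card A : ℝ)⁻¹) ^ K * φ (fun k => f (e k)) else 0 := by
    intro E
    simp_rw [toReal_map_uniformOfFintype]
    rw [Finset.prod_univ_sum, Fintype.piFinset_univ, Finset.sum_mul]
    refine Finset.sum_congr rfl fun e _ => ?_
    by_cases h : E = fun k => f (e k)
    · rw [if_pos h, h]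
      simp
    · rw [if_neg h]
      obtain ⟨k, hk⟩ := Function.ne_iff.1 h
      rw [Finset.prod_eq_zero (Finset.mem_univ k) (if_neg hk), zero_mul]
  simp_rw [h1]
  rw [Finset.sum_comm]
  simp only [Finset.sum_ite_eq', Finset.mem_univ, if_true]
  rw [Fintype.expect_eq_sum_div_card, ← Finset.mul_sum]
  simp [div_eq_inv_mul]

theorem meanLoad_oneLinP {𝔽 : Type*} [Field 𝔽] [Fintype 𝔽] (K N B : ℕ) (γ ε : ℝ) :
    meanLoad K ε (oneLinP 𝔽 N γ B) = Finset.univ.expect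
      (fun e : Placement 𝔽 K N B ⌊γ * B⌋₊ => minLoad ε fun k => Matrix.blockDiagonal (e k)) := by
  unfold meanLoad oneLinP
  rw [sum_prod_map_uniformOfFintype]

theorem meanLoad_oneLinP_le {𝔽 : Type*} [Field 𝔽] [Fintype 𝔽] (K N B : ℕ) (γ : ℝ) {ε : ℝ}
    (hε : 0 < ε) : meanLoad K ε (oneLinP 𝔽 N γ B) ≤ N := by
  rw [meanLoad_oneLinP]
  exact Finset.expect_le Finset.univ_nonempty fun e _ => minLoad_le hε _

theorem meanLoad_oneLinP_nonneg {𝔽 : Type*} [Field 𝔽] [Fintype 𝔽] (K N B : ℕ) (γ ε : ℝ) :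
    0 ≤ meanLoad K ε (oneLinP 𝔽 N γ B) := by
  rw [meanLoad_oneLinP]
  exact Finset.expect_nonneg fun e _ => minLoad_nonneg _ _

theorem le_expectedLoad_oneLinP {𝔽 : Type*} [Field 𝔽] [Fintype 𝔽] {K N : ℕ} {γ ε x c : ℝ}
    (hε : 0 < ε) (h : ∀ B : ℕ, 0 < B → x - c / B ≤ meanLoad K ε (oneLinP 𝔽 N γ B)) :
    x ≤ expectedLoad K (oneLinP 𝔽 N γ) := by
  have hb : ∀ ε : ℝ, 0 < ε → Filter.IsBoundedUnder (· ≤ ·) Filter.atTop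
      (fun B : ℕ => meanLoad K ε (oneLinP 𝔽 N γ B)) := fun ε hε =>
    Filter.isBoundedUnder_of ⟨N, fun B => meanLoad_oneLinP_le K N B γ hε⟩
  have hb' : ∀ ε : ℝ, Filter.IsBoundedUnder (· ≥ ·) Filter.atTop
      (fun B : ℕ => meanLoad K ε (oneLinP 𝔽 N γ B)) := fun ε =>
    Filter.isBoundedUnder_of ⟨0, fun B => meanLoad_oneLinP_nonneg K N B γ ε⟩
  have ht : Filter.Tendsto (fun B : ℕ => x - c / B) Filter.atTop (nhds x) := by
    simpa using tendsto_const_nhds.sub (tendsto_const_div_atTop_nhds_zero_nat c)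
  have h1 : x ≤ Filter.limsup (fun B : ℕ => meanLoad K ε (oneLinP 𝔽 N γ B)) Filter.atTop := by
    rw [← ht.limsup_eq]
    refine Filter.limsup_le_limsup ?_ ht.isCoboundedUnder_le (hb ε hε)
    filter_upwards [Filter.eventually_gt_atTop 0] with B hB using h B hB
  refine h1.trans (le_ciSup (f := fun ε : Set.Ioi (0 : ℝ) =>
    Filter.limsup (fun B : ℕ => meanLoad K (ε : ℝ) (oneLinP 𝔽 N γ B)) Filter.atTop) ?_ ⟨ε, hε⟩)
  refine ⟨N, ?_⟩
  rintro _ ⟨⟨ε', hε'⟩, rfl⟩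
  exact Filter.limsup_le_of_le (hb' ε').isCoboundedUnder_le
    (Filter.Eventually.of_forall fun B => meanLoad_oneLinP_le K N B γ hε')

/-! ### Counting converse with distinct demands: Δ₁ -/

theorem card_signal_prod_quotient {𝔽 : Type*} [Field 𝔽] [Fintype 𝔽]
    {N B L : ℕ} (W : Fin N → Submodule 𝔽 (Fin B → 𝔽)) :
    Nat.card ((Fin L → 𝔽) × ∀ n, (Fin B → 𝔽) ⧸ W n) =
      Fintype.card 𝔽 ^ (L + ∑ n, Module.finrank 𝔽 ((Fin B → 𝔽) ⧸ W n)) := by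
  rw [Nat.card_prod, pow_add, ← Finset.prod_pow_eq_pow_sum]
  refine congrArg₂ (· * ·) (by simp)
    (Nat.card_pi.trans (Finset.prod_congr rfl fun n _ => ?_))
  rw [Module.natCard_eq_pow_finrank (K := 𝔽), Nat.card_eq_fintype_card]

theorem card_library (𝔽 : Type*) [Fintype 𝔽] (N B : ℕ) :
    Fintype.card (Library 𝔽 N B) = Fintype.card 𝔽 ^ (N * B) := by
  simp [Library, ← pow_mul, mul_comm]

/-- The signal and the files modulo `W` label the libraries of `G` injectively. The final 1 absorbs
the factor 2 in `hG`, because 2 ≤ q. -/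
theorem mul_le_of_injOn {𝔽 : Type*} [Field 𝔽] [Fintype 𝔽]
    {N B L : ℕ} {G : Finset (Library 𝔽 N B)}
    (hG : (Fintype.card (Library 𝔽 N B) : ℝ) ≤ 2 * G.card) (X : Library 𝔽 N B → Fin L → 𝔽)
    (W : Fin N → Submodule 𝔽 (Fin B → 𝔽))
    (h : ∀ F ∈ G, ∀ F' ∈ G, X F = X F' → (∀ n, F n - F' n ∈ W n) → F = F') :
    N * B ≤ L + ∑ n, Module.finrank 𝔽 ((Fin B → 𝔽) ⧸ W n) + 1 := by
  have h1 : G.card ≤ Nat.card ((Fin L → 𝔽) × ∀ n, (Fin B → 𝔽) ⧸ W n) := by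
    rw [← Fintype.card_coe, ← Nat.card_eq_fintype_card]
    refine Nat.card_le_card_of_injective
      (fun F : G => (X F, fun n => (W n).mkQ (F.1 n))) fun F F' hFF' => ?_
    simp only [Prod.mk.injEq] at hFF'
    refine Subtype.ext (h F F.2 F' F'.2 hFF'.1 fun n => ?_)
    exact (Submodule.Quotient.eq _).1 (congrFun hFF'.2 n)
  rw [card_signal_prod_quotient] at h1
  have hq := two_le_card 𝔽
  have h2 : Fintype.card 𝔽 ^ (N * B) ≤ 2 * G.card := by
    rw [← card_library 𝔽]; exact_mod_cast hG
  refine (Nat.pow_le_pow_iff_right hq).1 (h2.trans ?_)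
  rw [pow_succ, mul_comm]
  exact Nat.mul_le_mul h1 hq

theorem finrank_quotient_ker_le {𝔽 : Type*} [Field 𝔽]
    {B : ℕ} {M : Type*} [AddCommGroup M] [Module 𝔽 M]
    [Module.Finite 𝔽 M] (f : (Fin B → 𝔽) →ₗ[𝔽] M) :
    Module.finrank 𝔽 ((Fin B → 𝔽) ⧸ LinearMap.ker f) ≤ Module.finrank 𝔽 M := by
  rw [f.quotKerEquivRange.finrank_eq]
  exact Submodule.finrank_le _

theorem finrank_quotient_le {𝔽 : Type*} [Field 𝔽]
    {B : ℕ} (W : Submodule 𝔽 (Fin B → 𝔽)) :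
    Module.finrank 𝔽 ((Fin B → 𝔽) ⧸ W) ≤ B := by
  simpa using Submodule.finrank_quotient_le W

/-- The vectors of file `n` that are invisible to all of the users `0, …, n`. -/
noncomputable def commonKernel {𝔽 : Type*} [Field 𝔽] {K N B m : ℕ} (e : Placement 𝔽 K N B m)
    (n : Fin N) : Submodule 𝔽 (Fin B → 𝔽) :=
  LinearMap.ker (LinearMap.pi fun k : {k : Fin K // (k : ℕ) ≤ n} => (e k n)ᵀ.mulVecLin)

theorem finrank_quotient_commonKernel_le {𝔽 : Type*} [Field 𝔽]
    {K N B m : ℕ} (e : Placement 𝔽 K N B m) (n : Fin N) :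
    Module.finrank 𝔽 ((Fin B → 𝔽) ⧸ commonKernel e n) ≤ (n + 1) * m := by
  refine (finrank_quotient_ker_le _).trans ?_
  simp only [Module.finrank_pi_fintype, Fintype.card_fin, Finset.sum_const, smul_eq_mul,
    Finset.card_univ, Module.finrank_self, mul_one]
  refine Nat.mul_le_mul_right m ?_
  have : Function.Injective
      (fun k : {k : Fin K // (k : ℕ) ≤ n} => (⟨k.1, Nat.lt_succ_of_le k.2⟩ : Fin (n + 1))) := by
    intro k k' h
    apply Subtype.ext
    apply Fin.ext
    simpa using h
  simpa using Fintype.card_le_of_injective _ this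

theorem mem_cacheKernel_of_mem_commonKernel {𝔽 : Type*} [Field 𝔽]
    {K N B m : ℕ} {e : Placement 𝔽 K N B m} {n : Fin N}
    {x : Fin B → 𝔽} (hx : x ∈ commonKernel e n) {k : Fin K} (hk : (k : ℕ) ≤ n) :
    x ∈ cacheKernel e n k := by
  rw [commonKernel, LinearMap.mem_ker] at hx
  exact congrFun hx ⟨k, hk⟩

/-- The converse for one placement, when users demand distinct files as long as possible. -/
theorem sum_sub_one_le_signalLength {𝔽 : Type*} [Field 𝔽] [Fintype 𝔽]
    {K N B m L : ℕ} (hN : 1 ≤ N) (hK : 1 ≤ K)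
    (e : Placement 𝔽 K N B m) (S : DeliveryScheme 𝔽 K N B (Fin m × Fin N) L)
    (hS : ∀ D k, S.errorProb (fun k => Matrix.blockDiagonal (e k)) D k ≤ 1 / (2 * K)) :
    ∑ t ∈ Finset.Icc 1 (min N K), max 0 ((B : ℝ) - t * m) - 1 ≤ L := by
  -- Users with index at least N get a dummy demand for file 0, which is never exploited.
  set D : Matrix (Fin K) (Fin N) 𝔽 := fun k =>
    Pi.single (if h : (k : ℕ) < N then ⟨k, h⟩ else ⟨0, hN⟩) 1 with hD
  have hG := S.card_le_two_mul_card_goodSet hK _ D (hS D)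
  -- Files with index at least K are demanded by nobody and are given away completely, hence ⊥.
  set W : Fin N → Submodule 𝔽 (Fin B → 𝔽) := fun n =>
    if (n : ℕ) < K then commonKernel e n else ⊥ with hW
  have hWle : ∀ {n : Fin N} {x : Fin B → 𝔽}, x ∈ W n → ∀ {k : Fin K}, (k : ℕ) ≤ n →
      x ∈ cacheKernel e n k := by
    intro n x hx k hk
    simp only [hW] at hx
    split_ifs at hx
    · exact mem_cacheKernel_of_mem_commonKernel hx hk
    · rw [(Submodule.mem_bot 𝔽).1 hx]; exact Submodule.zero_mem _
  have key := mul_le_of_injOn hG (S.encode D) W (by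
    intro F hF F' hF' hX h
    -- Successive decoding: to user i the two libraries look alike, since files before i agree by
    -- induction and the later ones differ by vectors invisible to user i.
    have hind : ∀ i (hi : i < N), F ⟨i, hi⟩ = F' ⟨i, hi⟩ := by
      intro i
      induction i using Nat.strong_induction_on with
      | _ i ih =>
        intro hi
        by_cases hiK : i < K
        · have := DeliveryScheme.demanded_eq hF hF' ⟨i, hiK⟩ hX (by
            intro n
            by_cases hn : (n : ℕ) < i
            · rw [ih n hn n.2, sub_self]; exact Submodule.zero_mem _
            · exact hWle (h n) (by simpa using hn))
          simp only [hD, hi, dif_pos, demanded_single] at this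
          exact this
        · have := h ⟨i, hi⟩
          simp only [hW, hiK, if_false] at this
          exact sub_eq_zero.1 ((Submodule.mem_bot 𝔽).1 this)
    funext n
    exact hind n n.2)
  have key' : (N : ℝ) * B ≤ L + ∑ n, (Module.finrank 𝔽 ((Fin B → 𝔽) ⧸ W n) : ℝ) + 1 := by
    exact_mod_cast key
  have h1 : ∑ t ∈ Finset.Icc 1 (min N K), max 0 ((B : ℝ) - t * m) ≤
      ∑ n : Fin N, ((B : ℝ) - Module.finrank 𝔽 ((Fin B → 𝔽) ⧸ W n)) := by
    calc _ = ∑ i ∈ Finset.range (min N K), max 0 ((B : ℝ) - (i + 1 : ℕ) * m) := by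
          rw [Finset.range_eq_Ico, Finset.sum_Ico_add' (fun i : ℕ => max 0 ((B : ℝ) - i * m)) 0 _ 1]
          rfl
      _ ≤ ∑ i ∈ Finset.range N, if i < K then max 0 ((B : ℝ) - (i + 1 : ℕ) * m) else 0 := by
          rw [← Finset.sum_filter]
          refine le_of_eq (Finset.sum_congr ?_ fun _ _ => rfl)
          ext i
          simp
      _ = ∑ n : Fin N, if (n : ℕ) < K then max 0 ((B : ℝ) - ((n : ℕ) + 1 : ℕ) * m) else 0 :=
          Finset.sum_range _
      _ ≤ _ := by
          refine Finset.sum_le_sum fun n _ => ?_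
          have h2 : (Module.finrank 𝔽 ((Fin B → 𝔽) ⧸ W n) : ℝ) ≤ B := by
            exact_mod_cast finrank_quotient_le (W n)
          split_ifs with hn
          · refine max_le (by linarith) ?_
            have h3 : (Module.finrank 𝔽 ((Fin B → 𝔽) ⧸ W n) : ℝ) ≤ ((n : ℕ) + 1 : ℕ) * m := by
              rw [show W n = commonKernel e n from if_pos hn]
              exact_mod_cast finrank_quotient_commonKernel_le e n
            linarith
          · linarith
  rw [Finset.sum_sub_distrib] at h1
  simp only [Finset.sum_const, Finset.card_univ, Fintype.card_fin, nsmul_eq_mul] at h1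
  linarith

theorem delta₁_le_expectedLoad {𝔽 : Type*} [Field 𝔽] [Fintype 𝔽] {N K : ℕ} (hN : 1 ≤ N)
    (hK : 1 ≤ K) {γ : ℝ} (hγ₀ : 0 ≤ γ) :
    delta₁ N K γ ≤ expectedLoad K (oneLinP 𝔽 N γ) := by
  have hK0 : (0 : ℝ) < K := by exact_mod_cast hK
  have hε : (0 : ℝ) < 1 / (2 * K) := by positivity
  refine le_expectedLoad_oneLinP (c := 1) hε fun B hB => ?_
  have hB0 : (0 : ℝ) < B := by exact_mod_cast hB
  rw [meanLoad_oneLinP]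
  refine Finset.le_expect Finset.univ_nonempty fun e _ => ?_
  have h := div_le_minLoad hε hB (fun k => Matrix.blockDiagonal (e k))
    fun L S hS => sum_sub_one_le_signalLength hN hK e S hS
  refine le_trans ?_ h
  rw [sub_div, delta₁, Finset.sum_div]
  refine sub_le_sub_right (Finset.sum_le_sum fun t _ => ?_) _
  rw [le_div_iff₀ hB0]
  have hm : (⌊γ * B⌋₊ : ℝ) ≤ γ * B := Nat.floor_le (by positivity)
  have ht : (0 : ℝ) ≤ t := by positivity
  rcases le_total 0 (1 - t * γ) with h0 | h0
  · rw [max_eq_right h0]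
    refine le_trans ?_ (le_max_right _ _)
    nlinarith
  · rw [max_eq_left h0, zero_mul]
    exact le_max_left _ _

/-! ### Entropy of one file modulo a subspace -/

/-- Two libraries are related if they have the same value of `X`, and the same files up to a vector
of `P` in file `n`. -/
def fileSetoid {𝔽 : Type*} [Field 𝔽] {N B : ℕ} {β : Type*} (X : Library 𝔽 N B → β) (n : Fin N)
    (P : Submodule 𝔽 (Fin B → 𝔽)) : Setoid (Library 𝔽 N B) where
  r F F' := X F = X F' ∧ (∀ n', n' ≠ n → F n' = F' n') ∧ F n - F' n ∈ P
  iseqv :=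
    { refl := fun F => ⟨rfl, fun _ _ => rfl, by simp⟩
      symm := fun {F F'} h => ⟨h.1.symm, fun n' hn => (h.2.1 n' hn).symm, by
        rw [← neg_sub]; exact P.neg_mem h.2.2⟩
      trans := fun {F F' F''} h h' => ⟨h.1.trans h'.1,
        fun n' hn => (h.2.1 n' hn).trans (h'.2.1 n' hn), by
        rw [← sub_add_sub_cancel]; exact P.add_mem h.2.2 h'.2.2⟩ }

theorem fileSetoid_iff {𝔽 : Type*} [Field 𝔽] {N B : ℕ} {β : Type*} {X : Library 𝔽 N B → β}
    {n : Fin N} {P : Submodule 𝔽 (Fin B → 𝔽)} {F F' : Library 𝔽 N B} :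
    fileSetoid X n P F F' ↔
      X F = X F' ∧ (∀ n', n' ≠ n → F n' = F' n') ∧ F n - F' n ∈ P := Iff.rfl

theorem fileSetoid_mono {𝔽 : Type*} [Field 𝔽] {N B : ℕ} {β : Type*} (X : Library 𝔽 N B → β)
    (n : Fin N) {P Q : Submodule 𝔽 (Fin B → 𝔽)} (h : P ≤ Q) :
    fileSetoid X n P ≤ fileSetoid X n Q :=
  fun {_ _} hF => ⟨hF.1, hF.2.1, h hF.2.2⟩

theorem logClassSum_fileSetoid_add_le {𝔽 : Type*} [Field 𝔽] {N B : ℕ} {β : Type*}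
    (X : Library 𝔽 N B → β) (n : Fin N) (G : Finset (Library 𝔽 N B))
    (P Q : Submodule 𝔽 (Fin B → 𝔽)) :
    logClassSum G (fileSetoid X n P) + logClassSum G (fileSetoid X n Q) ≤
      logClassSum G (fileSetoid X n (P ⊓ Q)) + logClassSum G (fileSetoid X n (P ⊔ Q)) := by
  refine logClassSum_add_le G ?_ (fileSetoid_mono X n le_sup_left)
    (fileSetoid_mono X n le_sup_right)
  intro F F' h
  have h1 := fileSetoid_iff.1 (Setoid.inf_def ▸ h : (fileSetoid X n P ⊓ fileSetoid X n Q) F F').1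
  have h2 := fileSetoid_iff.1 (Setoid.inf_def ▸ h : (fileSetoid X n P ⊓ fileSetoid X n Q) F F').2
  exact ⟨h1.1, h1.2.1, h1.2.2, h2.2.2⟩

theorem finrank_map_mkQ_add {𝔽 V : Type*} [Field 𝔽] [AddCommGroup V] [Module 𝔽 V]
    [FiniteDimensional 𝔽 V] (P W : Submodule 𝔽 V) :
    Module.finrank 𝔽 (P.map W.mkQ) + Module.finrank 𝔽 W =
      Module.finrank 𝔽 (P ⊔ W : Submodule 𝔽 V) := by
  have h1 := LinearMap.finrank_range_add_finrank_ker (W.mkQ.domRestrict P)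
  have h2 := Submodule.finrank_sup_add_finrank_inf_eq P W
  have h3 : LinearMap.range (W.mkQ.domRestrict P) = P.map W.mkQ := by
    rw [LinearMap.range_domRestrict]
  have h4 : Module.finrank 𝔽 (LinearMap.ker (W.mkQ.domRestrict P)) =
      Module.finrank 𝔽 (P ⊓ W : Submodule 𝔽 V) := by
    rw [LinearMap.ker_domRestrict, Submodule.ker_mkQ, inf_comm]
    rw [← (Submodule.comapSubtypeEquivOfLe (p := W ⊓ P) (q := P) inf_le_right).finrank_eq]
    rw [show Submodule.comap P.subtype (W ⊓ P) = Submodule.comap P.subtype W by ext x; simp]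
  rw [h3, h4] at h1
  omega

/-- Knowledge of the distinguished file modulo `W` separates the members of a class, and within a
class this residue varies only in a translate of the image of `P`. -/
theorem card_class_fileSetoid_le {𝔽 : Type*} [Field 𝔽] [Fintype 𝔽] {N B : ℕ} {β : Type*}
    {X : Library 𝔽 N B → β} {n : Fin N} {G : Finset (Library 𝔽 N B)}
    {W : Submodule 𝔽 (Fin B → 𝔽)}
    (h : ∀ F ∈ G, ∀ F' ∈ G, fileSetoid X n W F F' → F = F') (P : Submodule 𝔽 (Fin B → 𝔽))
    (F : Library 𝔽 N B) :
    (G.filter (fun F' => fileSetoid X n P F F')).card ≤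
      Fintype.card 𝔽 ^ Module.finrank 𝔽 (P.map W.mkQ) := by
  rw [← Nat.card_eq_fintype_card (α := 𝔽), ← Module.natCard_eq_pow_finrank (K := 𝔽),
    ← Fintype.card_coe, ← Nat.card_eq_fintype_card]
  have hmem : ∀ F' : G.filter (fun F' => fileSetoid X n P F F'), F'.1 ∈ G ∧
      fileSetoid X n P F F' := fun F' =>
    Finset.mem_filter.1 F'.2
  refine Nat.card_le_card_of_injective (fun F' : G.filter (fun F' => fileSetoid X n P F F') =>
    (⟨W.mkQ (F n - F'.1 n), Submodule.mem_map_of_mem (hmem F').2.2.2⟩ : P.map W.mkQ)) ?_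
  intro F₁ F₂ h12
  obtain ⟨hG1, hX1, hn1, -⟩ := hmem F₁
  obtain ⟨hG2, hX2, hn2, -⟩ := hmem F₂
  refine Subtype.ext (h _ hG1 _ hG2 ⟨hX1.symm.trans hX2, fun n' hn =>
    (hn1 n' hn).symm.trans (hn2 n' hn), ?_⟩)
  have h3 := (Submodule.Quotient.eq W).1 (Subtype.ext_iff.1 h12).symm
  rwa [sub_sub_sub_cancel_left] at h3

theorem logClassSum_nonneg {Ω : Type*} (G : Finset Ω) (s : Setoid Ω) : 0 ≤ logClassSum G s :=
  Finset.sum_nonneg fun _ _ => Real.log_natCast_nonneg _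

/-- Iterated submodularity along a sequence of subspaces. -/
theorem sum_le_of_submodular {𝔽 V : Type*} [Field 𝔽] [AddCommGroup V] [Module 𝔽 V]
    [FiniteDimensional 𝔽 V] {a : Submodule 𝔽 V → ℝ} {W₀ : Submodule 𝔽 V} {m : ℕ}
    (hsub : ∀ P Q, a P + a Q ≤ a (P ⊓ Q) + a (P ⊔ Q)) (hbot : 0 ≤ a ⊥)
    (hle : ∀ P, a P + Module.finrank 𝔽 W₀ ≤ Module.finrank 𝔽 (P ⊔ W₀ : Submodule 𝔽 V))
    (hW₀ : Module.finrank 𝔽 V ≤ Module.finrank 𝔽 W₀ + m) (W : ℕ → Submodule 𝔽 V) {n : ℕ}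
    (hn : 1 ≤ n) :
    ∑ i ∈ Finset.range n, a (W i) ≤
      (Module.finrank 𝔽 ((Finset.range n).sup W ⊔ W₀ : Submodule 𝔽 V) - Module.finrank 𝔽 W₀ +
        Module.finrank 𝔽 (W 0) - Module.finrank 𝔽 ((Finset.range n).sup W : Submodule 𝔽 V) : ℝ) +
      ∑ i ∈ Finset.Ico 1 n, min (Module.finrank 𝔽 (W i) : ℝ)
        (m + (Module.finrank 𝔽 V - Module.finrank 𝔽
          ((Finset.range i).sup W : Submodule 𝔽 V))) := by
  set U : ℕ → Submodule 𝔽 V := fun i => (Finset.range i).sup W with hU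
  have hU0 : U 0 = ⊥ := by simp [hU]
  have hUs : ∀ i, U (i + 1) = U i ⊔ W i := fun i => by
    simp only [hU, Finset.range_add_one, Finset.sup_insert, sup_comm]
  have hUone : U 1 = W 0 := by rw [hUs, hU0, bot_sup_eq]
  have hdim : ∀ P : Submodule 𝔽 V, (Module.finrank 𝔽 P : ℝ) ≤ Module.finrank 𝔽 V := fun P => by
    exact_mod_cast Submodule.finrank_le P
  -- Each subspace is merged into the running sum `U i`, at the price of the intersection term.
  have h1 : ∀ i, ∑ j ∈ Finset.range i, a (W j) ≤
      a (U i) + ∑ j ∈ Finset.range i, a (U j ⊓ W j) := by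
    intro i
    induction i with
    | zero => simpa [hU0] using hbot
    | succ i ih =>
      rw [Finset.sum_range_succ, Finset.sum_range_succ, hUs]
      linarith [hsub (U i) (W i)]
  have h2 : a (U 0 ⊓ W 0) ≤ 0 := by
    have := hle ⊥
    rw [bot_sup_eq] at this
    rw [hU0, bot_inf_eq]
    linarith
  -- An intersection has `a` at most its dimension and at most m, the bound on the codimension of
  -- `W₀`. The bound m is weakened by the codimension of `U (i + 1)`, so that the same difference of
  -- dimensions splits off from both bounds and telescopes.
  have h3 : ∀ i, a (U i ⊓ W i) ≤ min (Module.finrank 𝔽 (W i) : ℝ)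
      (m + (Module.finrank 𝔽 V - Module.finrank 𝔽 (U i))) +
      (Module.finrank 𝔽 (U i) - Module.finrank 𝔽 (U (i + 1))) := by
    intro i
    rw [← sub_le_iff_le_add]
    have h4 := hle (U i ⊓ W i)
    have h5 : (Module.finrank 𝔽 (U i ⊔ W i : Submodule 𝔽 V) : ℝ) +
        Module.finrank 𝔽 (U i ⊓ W i : Submodule 𝔽 V) =
        Module.finrank 𝔽 (U i) + Module.finrank 𝔽 (W i) := by
      exact_mod_cast Submodule.finrank_sup_add_finrank_inf_eq (U i) (W i)
    have h6 : (Module.finrank 𝔽 ((U i ⊓ W i) ⊔ W₀ : Submodule 𝔽 V) : ℝ) ≤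
        Module.finrank 𝔽 (U i ⊓ W i : Submodule 𝔽 V) + Module.finrank 𝔽 W₀ := by
      exact_mod_cast Submodule.finrank_add_le_finrank_add_finrank _ _
    have h7 := hdim ((U i ⊓ W i) ⊔ W₀)
    have h8 := hdim (U (i + 1))
    have h9 : (Module.finrank 𝔽 V : ℝ) ≤ Module.finrank 𝔽 W₀ + m := by exact_mod_cast hW₀
    rw [← hUs] at h5
    refine le_min ?_ ?_ <;> linarith
  have h10 := h1 n
  rw [Finset.range_eq_Ico, Finset.sum_eq_sum_Ico_succ_bot (by omega : 0 < n)
    (fun j => a (U j ⊓ W j))] at h10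
  have h11 : ∑ j ∈ Finset.Ico (0 + 1) n, a (U j ⊓ W j) ≤
      ∑ i ∈ Finset.Ico 1 n, min (Module.finrank 𝔽 (W i) : ℝ)
        (m + (Module.finrank 𝔽 V - Module.finrank 𝔽 (U i))) +
      (Module.finrank 𝔽 (U 1) - Module.finrank 𝔽 (U n)) := by
    refine (Finset.sum_le_sum fun i _ => h3 i).trans ?_
    rw [Finset.sum_add_distrib]
    refine add_le_add le_rfl (le_of_eq ?_)
    have := Finset.sum_Ico_sub (fun i => (Module.finrank 𝔽 (U i) : ℝ)) hn
    rw [← neg_sub, ← this, ← Finset.sum_neg_distrib]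
    simp
  have h12 := hle (U n)
  rw [hUone] at h11
  rw [← Finset.range_eq_Ico] at h10
  linarith

/-! ### Two-file converse for a fixed placement -/

/-- The vectors of the first file that are invisible to user `j + 1`. -/
noncomputable def laterKernel {𝔽 : Type*} [Field 𝔽] {n N B m : ℕ}
    (e : Placement 𝔽 (n + 1) (N + 2) B m) (j : ℕ) : Submodule 𝔽 (Fin B → 𝔽) :=
  if h : j < n then cacheKernel e 0 (Fin.succ ⟨j, h⟩) else ⊥

/-- The signal, the m symbols that user k caches of each of files 0 and 1, and all further files let
user k recover file 1. They therefore determine the class, whose entropy is at most L + 2m + NB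
symbols; the library itself has at least (N + 2)B - 1. -/
theorem le_logClassSum_cacheKernel {𝔽 : Type*} [Field 𝔽] [Fintype 𝔽] {n N B m L : ℕ}
    {e : Placement 𝔽 (n + 1) (N + 2) B m}
    {S : DeliveryScheme 𝔽 (n + 1) (N + 2) B (Fin m × Fin (N + 2)) L}
    {D : Matrix (Fin (n + 1)) (Fin (N + 2)) 𝔽}
    (hG : (Fintype.card (Library 𝔽 (N + 2) B) : ℝ) ≤
      2 * (S.goodSet (fun k => Matrix.blockDiagonal (e k)) D).card)
    {k : Fin (n + 1)} (hD : D k = Pi.single 1 1) :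
    (S.goodSet (fun k => Matrix.blockDiagonal (e k)) D).card *
        ((2 * B - 2 * m - 1 - L : ℝ) * Real.log (Fintype.card 𝔽)) ≤
      logClassSum (S.goodSet (fun k => Matrix.blockDiagonal (e k)) D)
        (fileSetoid (S.encode D) 0 (cacheKernel e 0 k)) := by
  set G := S.goodSet (fun k => Matrix.blockDiagonal (e k)) D with hGdef
  set q := Fintype.card 𝔽 with hq
  have hq2 : (2 : ℝ) ≤ q := by exact_mod_cast two_le_card 𝔽
  have hlog : 0 < Real.log q := Real.log_pos (by linarith)
  set W : Fin (N + 2) → Submodule 𝔽 (Fin B → 𝔽) :=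
    Fin.cons (cacheKernel e 0 k) (Fin.cons (cacheKernel e 1 k) fun _ => ⊥) with hW
  have hTpos : (0 : ℝ) < Fintype.card (Library 𝔽 (N + 2) B) := by
    exact_mod_cast Fintype.card_pos
  have hGpos : (0 : ℝ) < G.card := by linarith
  have : Fintype ((Fin L → 𝔽) × ∀ n, (Fin B → 𝔽) ⧸ W n) := Fintype.ofFinite _
  have h1 := le_logClassSum G (Finset.card_pos.1 (by exact_mod_cast hGpos))
    (fileSetoid (S.encode D) 0 (cacheKernel e 0 k))
    (fun F => ((S.encode D F, fun n => (W n).mkQ (F n)) :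
      (Fin L → 𝔽) × ∀ n, (Fin B → 𝔽) ⧸ W n)) (by
      intro F hF F' hF' h
      simp only [Prod.mk.injEq] at h
      have h2 : ∀ n, F n - F' n ∈ W n := fun n =>
        (Submodule.Quotient.eq _).1 (congrFun h.2 n)
      have h3 : ∀ i : Fin N, F i.succ.succ = F' i.succ.succ := fun i =>
        sub_eq_zero.1 ((Submodule.mem_bot 𝔽).1 (h2 i.succ.succ))
      have h4 : ∀ n, F n - F' n ∈ cacheKernel e n k := by
        intro n
        refine Fin.cases (h2 0) (fun i => ?_) n
        refine Fin.cases (h2 1) (fun i => ?_) i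
        rw [h3, sub_self]
        exact Submodule.zero_mem _
      have h5 := DeliveryScheme.demanded_eq hF hF' k h.1 h4
      rw [hD, demanded_single, demanded_single] at h5
      refine ⟨h.1, fun n' => ?_, h2 0⟩
      refine Fin.cases (fun h => absurd rfl h) (fun i _ => ?_) n'
      exact Fin.cases h5 h3 i)
  refine le_trans ?_ h1
  refine mul_le_mul_of_nonneg_left ?_ hGpos.le
  have h6 : ∑ n, Module.finrank 𝔽 ((Fin B → 𝔽) ⧸ W n) ≤ 2 * m + N * B := by
    rw [Fin.sum_univ_succ, Fin.sum_univ_succ]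
    have h7 : ∀ n', Module.finrank 𝔽 ((Fin B → 𝔽) ⧸ cacheKernel e n' k) ≤ m := fun n' =>
      (finrank_quotient_ker_le (e k n')ᵀ.mulVecLin).trans (by simp)
    have h8 : ∑ i : Fin N, Module.finrank 𝔽 ((Fin B → 𝔽) ⧸ W i.succ.succ) ≤ N * B := by
      refine (Finset.sum_le_sum fun i _ => finrank_quotient_le (W i.succ.succ)).trans ?_
      simp
    have h9 : Module.finrank 𝔽 ((Fin B → 𝔽) ⧸ W 0) ≤ m := h7 0
    have h10 : Module.finrank 𝔽 ((Fin B → 𝔽) ⧸ W (Fin.succ 0)) ≤ m := h7 1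
    omega
  rw [← Nat.card_eq_fintype_card, card_signal_prod_quotient, ← hq]
  push_cast
  rw [Real.log_pow]
  have h11 : ((N + 2 : ℕ) * B : ℝ) * Real.log q - Real.log q ≤ Real.log G.card := by
    have h12 := Real.log_le_log hTpos hG
    rw [card_library, ← hq, Real.log_mul two_ne_zero hGpos.ne'] at h12
    push_cast at h12 ⊢
    rw [Real.log_pow] at h12
    push_cast at h12
    have h13 := Real.log_le_log (by norm_num) hq2
    linarith
  have h14 : ((L + ∑ n, Module.finrank 𝔽 ((Fin B → 𝔽) ⧸ W n) : ℕ) : ℝ) * Real.log q ≤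
      (L + (2 * m + N * B) : ℝ) * Real.log q := by
    refine mul_le_mul_of_nonneg_right ?_ hlog.le
    exact_mod_cast Nat.add_le_add_left h6 L
  push_cast at h11 h14 ⊢
  linarith

/-- The dimension count that bounds the saving due to overlapping caches. -/
noncomputable def overlapBound {𝔽 : Type*} [Field 𝔽] {n N B m : ℕ}
    (e : Placement 𝔽 (n + 1) (N + 2) B m) : ℝ :=
  min (B : ℝ) (∑ k, (Module.finrank 𝔽 (cacheKernel e 0 k) : ℝ)) - (B - m) +
    Module.finrank 𝔽 (laterKernel e 0) -
    Module.finrank 𝔽 ((Finset.range n).sup (laterKernel e) : Submodule 𝔽 (Fin B → 𝔽)) +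
  ∑ i ∈ Finset.Ico 1 n, min (Module.finrank 𝔽 (laterKernel e i) : ℝ)
    (m + (B - Module.finrank 𝔽 ((Finset.range i).sup (laterKernel e) : Submodule 𝔽 (Fin B → 𝔽))))

theorem laterKernel_of_lt {𝔽 : Type*} [Field 𝔽] {n N B m : ℕ}
    (e : Placement 𝔽 (n + 1) (N + 2) B m) {j : ℕ} (h : j < n) :
    laterKernel e j = cacheKernel e 0 (Fin.succ ⟨j, h⟩) := dif_pos h

theorem sup_range_laterKernel {𝔽 : Type*} [Field 𝔽] {n N B m : ℕ}
    (e : Placement 𝔽 (n + 1) (N + 2) B m) {i : ℕ} (h : i ≤ n) :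
    (Finset.range i).sup (laterKernel e) =
      ⨆ j : Fin i, cacheKernel e 0 (Fin.succ (Fin.castLE h j)) := by
  apply le_antisymm
  · refine Finset.sup_le fun j hj => ?_
    have hj' := Finset.mem_range.1 hj
    rw [laterKernel_of_lt e (hj'.trans_le h)]
    exact le_iSup (fun j : Fin i => cacheKernel e 0 (Fin.succ (Fin.castLE h j))) ⟨j, hj'⟩
  · refine iSup_le fun j => ?_
    have := Finset.le_sup (f := laterKernel e) (Finset.mem_range.2 j.2)
    rwa [laterKernel_of_lt e (j.2.trans_le h)] at this

theorem finrank_iSup_le_sum {𝔽 V : Type*} [Field 𝔽] [AddCommGroup V] [Module 𝔽 V]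
    [FiniteDimensional 𝔽 V] {ι : Type*} (s : Finset ι) (W : ι → Submodule 𝔽 V) :
    Module.finrank 𝔽 (s.sup W : Submodule 𝔽 V) ≤ ∑ i ∈ s, Module.finrank 𝔽 (W i) := by
  induction s using Finset.induction_on with
  | empty => simp
  | insert i s hi ih =>
    rw [Finset.sup_insert, Finset.sum_insert hi]
    exact (Submodule.finrank_add_le_finrank_add_finrank _ _).trans (Nat.add_le_add_left ih _)

/-- The converse for one placement, when the first user demands the first file and all other users
demand the second one. -/
theorem mul_sub_overlapBound_le {𝔽 : Type*} [Field 𝔽] [Fintype 𝔽] {n N B m L : ℕ} (hn : 1 ≤ n)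
    (e : Placement 𝔽 (n + 1) (N + 2) B m)
    (S : DeliveryScheme 𝔽 (n + 1) (N + 2) B (Fin m × Fin (N + 2)) L)
    (hS : ∀ D k, S.errorProb (fun k => Matrix.blockDiagonal (e k)) D k ≤
      1 / (2 * (n + 1 : ℕ))) :
    n * (2 * B - 2 * m - 1 - L : ℝ) ≤ overlapBound e := by
  set D : Matrix (Fin (n + 1)) (Fin (N + 2)) 𝔽 := Fin.cons (Pi.single 0 1) fun _ => Pi.single 1 1
    with hD
  have hG := S.card_le_two_mul_card_goodSet (by omega) _ D (hS D)
  set G := S.goodSet (fun k => Matrix.blockDiagonal (e k)) D with hGdef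
  set q := Fintype.card 𝔽 with hq
  have hq2 : (2 : ℝ) ≤ q := by exact_mod_cast two_le_card 𝔽
  have hlog : 0 < Real.log q := Real.log_pos (by linarith)
  have hTpos : (0 : ℝ) < Fintype.card (Library 𝔽 (N + 2) B) := by
    exact_mod_cast Fintype.card_pos
  have hGpos : (0 : ℝ) < G.card := by linarith
  set c : ℝ := G.card * Real.log q with hc
  have hcpos : 0 < c := by positivity
  set a : Submodule 𝔽 (Fin B → 𝔽) → ℝ :=
    fun P => logClassSum G (fileSetoid (S.encode D) 0 P) / c with ha
  -- User 0 recovers file 0, and the relation already fixes all other files.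
  have hdec : ∀ F ∈ G, ∀ F' ∈ G, fileSetoid (S.encode D) 0 (cacheKernel e 0 0) F F' → F = F' := by
    intro F hF F' hF' h
    have h1 := DeliveryScheme.demanded_eq hF hF' 0 h.1 (by
      intro n'
      by_cases hn' : n' = 0
      · rw [hn']; exact h.2.2
      · rw [h.2.1 n' hn', sub_self]; exact Submodule.zero_mem _)
    rw [show D 0 = Pi.single 0 1 from rfl, demanded_single, demanded_single] at h1
    funext n'
    by_cases hn' : n' = 0
    · rw [hn']; exact h1
    · exact h.2.1 n' hn'
  have hB : Module.finrank 𝔽 (Fin B → 𝔽) = B := by simp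
  have hw0 : (B : ℝ) ≤ Module.finrank 𝔽 (cacheKernel e 0 0) + m := by
    exact_mod_cast le_finrank_cacheKernel e 0 0
  have key := sum_le_of_submodular (a := a) (W₀ := cacheKernel e 0 0) (m := m)
    (fun P Q => by
      simp only [ha]
      rw [← add_div, ← add_div]
      exact div_le_div_of_nonneg_right (logClassSum_fileSetoid_add_le _ _ _ _ _) hcpos.le)
    (div_nonneg (logClassSum_nonneg _ _) hcpos.le)
    (fun P => by
      have h1 : (Module.finrank 𝔽 (P.map (cacheKernel e 0 0).mkQ) : ℝ) +
          Module.finrank 𝔽 (cacheKernel e 0 0) =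
          Module.finrank 𝔽 (P ⊔ cacheKernel e 0 0 : Submodule 𝔽 (Fin B → 𝔽)) := by
        exact_mod_cast finrank_map_mkQ_add P (cacheKernel e 0 0)
      rw [← h1]
      refine add_le_add (div_le_of_le_mul₀ hcpos.le (by positivity) ?_) le_rfl
      refine (logClassSum_le G _ (M := (q : ℝ) ^ Module.finrank 𝔽
        (P.map (cacheKernel e 0 0).mkQ)) fun F _ => ?_).trans (le_of_eq ?_)
      · exact_mod_cast card_class_fileSetoid_le hdec P F
      · rw [Real.log_pow]; ring)
    (by rw [hB]; exact le_finrank_cacheKernel e 0 0) (laterKernel e) hn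
  have hlow : ∀ i ∈ Finset.range n, (2 * B - 2 * m - 1 - L : ℝ) ≤ a (laterKernel e i) := by
    intro i hi
    rw [laterKernel_of_lt e (Finset.mem_range.1 hi)]
    have := le_logClassSum_cacheKernel hG (k := Fin.succ ⟨i, Finset.mem_range.1 hi⟩) rfl
    rw [ha, le_div_iff₀ hcpos]
    calc _ = _ := by rw [hc]; ring
      _ ≤ _ := this
  have hsum := Finset.sum_le_sum hlow
  simp only [Finset.sum_const, Finset.card_range, nsmul_eq_mul] at hsum
  have hle : (Module.finrank 𝔽 ((Finset.range n).sup (laterKernel e) ⊔ cacheKernel e 0 0 :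
      Submodule 𝔽 (Fin B → 𝔽)) : ℝ) ≤
      min (B : ℝ) (∑ k, (Module.finrank 𝔽 (cacheKernel e 0 k) : ℝ)) := by
    refine le_min ?_ ?_
    · have := Submodule.finrank_le ((Finset.range n).sup (laterKernel e) ⊔ cacheKernel e 0 0)
      rw [hB] at this
      exact_mod_cast this
    · have h1 : (Finset.range n).sup (laterKernel e) ⊔ cacheKernel e 0 0 ≤
          Finset.univ.sup (cacheKernel e 0) := by
        refine sup_le (Finset.sup_le fun j hj => ?_) (Finset.le_sup (Finset.mem_univ 0))
        rw [laterKernel_of_lt e (Finset.mem_range.1 hj)]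
        exact Finset.le_sup (Finset.mem_univ _)
      exact_mod_cast (Submodule.finrank_mono h1).trans (finrank_iSup_le_sum _ _)
  rw [hB] at key
  unfold overlapBound
  linarith

/-! ### Averaging over the placement -/

theorem tau_mul_le {γ : ℝ} {s B m : ℕ} (hm : (m : ℝ) ≤ γ * B) :
    max 0 (s * m - (s - 1) * B : ℝ) ≤ tau γ s * B := by
  have hB : (0 : ℝ) ≤ B := by positivity
  have hs : (0 : ℝ) ≤ s := by positivity
  refine max_le (mul_nonneg (le_max_left _ _) hB) ?_
  calc (s * m - (s - 1) * B : ℝ) ≤ (1 - s * (1 - γ)) * B := by nlinarith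
    _ ≤ _ := mul_le_mul_of_nonneg_right (le_max_right _ _) hB

theorem expect_min_le {Ω : Type*} [Fintype Ω] [Nonempty Ω] {f g : Ω → ℝ} {x y : ℝ}
    (hf : Finset.univ.expect f ≤ x) (hg : Finset.univ.expect g ≤ y) :
    Finset.univ.expect (fun e => min (f e) (g e)) ≤ min x y :=
  le_min ((Finset.expect_le_expect fun _ _ => min_le_left _ _).trans hf)
    ((Finset.expect_le_expect fun _ _ => min_le_right _ _).trans hg)

theorem expect_overlapBound_le {𝔽 : Type*} [Field 𝔽] [Fintype 𝔽] {n N B m : ℕ} (hn : 1 ≤ n)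
    {γ : ℝ} (hm : (m : ℝ) ≤ γ * B) (hm' : γ * B ≤ m + 1) (hmB : m ≤ B) :
    Finset.univ.expect (fun e : Placement 𝔽 (n + 1) (N + 2) B m => overlapBound e) ≤
      (tau γ n - tau γ (n + 1) + ∑ i ∈ Finset.Ico 1 n, min (γ + tau γ i) (1 - γ)) * B +
        (4 * n + 4) := by
  have hB : (0 : ℝ) ≤ B := by positivity
  have hw : ∀ k, Finset.univ.expect (fun e : Placement 𝔽 (n + 1) (N + 2) B m =>
      (Module.finrank 𝔽 (cacheKernel e 0 k) : ℝ)) ≤ (B - m : ℝ) + 1 :=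
    fun k => expect_finrank_cacheKernel_le hmB 0 k
  have hl : ∀ i < n, Finset.univ.expect (fun e : Placement 𝔽 (n + 1) (N + 2) B m =>
      (Module.finrank 𝔽 (laterKernel e i) : ℝ)) ≤ (B - m : ℝ) + 1 := by
    intro i hi
    exact le_of_eq_of_le (Finset.expect_congr rfl fun e _ => by rw [laterKernel_of_lt e hi])
      (hw (Fin.succ ⟨i, hi⟩))
  have hu : ∀ i ≤ n, Finset.univ.expect (fun e : Placement 𝔽 (n + 1) (N + 2) B m =>
      (B - Module.finrank 𝔽 ((Finset.range i).sup (laterKernel e) :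
        Submodule 𝔽 (Fin B → 𝔽)) : ℝ)) ≤ tau γ i * B + 1 := by
    intro i hi
    have hinj : Function.Injective (fun j : Fin i => Fin.succ (Fin.castLE hi j)) :=
      (Fin.succ_injective n).comp (Fin.castLE_injective hi)
    have h := expect_codim_iSup_le (𝔽 := 𝔽) (B := B) (m := m) hinj (0 : Fin (N + 2))
    rw [Fintype.card_fin] at h
    refine le_of_eq_of_le (Finset.expect_congr rfl fun e _ => ?_)
      (h.trans (add_le_add (tau_mul_le hm) le_rfl))
    rw [sup_range_laterKernel e hi]
  have h1 : Finset.univ.expect (fun e : Placement 𝔽 (n + 1) (N + 2) B m =>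
      min (B : ℝ) (∑ k, (Module.finrank 𝔽 (cacheKernel e 0 k) : ℝ))) ≤
      B - tau γ (n + 1) * B + 2 * (n + 1) := by
    have h2 : Finset.univ.expect (fun e : Placement 𝔽 (n + 1) (N + 2) B m =>
        ∑ k, (Module.finrank 𝔽 (cacheKernel e 0 k) : ℝ)) ≤ (n + 1) * ((B - m : ℝ) + 1) := by
      rw [Finset.expect_sum_comm]
      refine (Finset.sum_le_sum fun k _ => hw k).trans (le_of_eq ?_)
      simp
      ring
    refine (expect_min_le (Fintype.expect_const (B : ℝ)).le h2).trans ?_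
    have hn0 : (0 : ℝ) ≤ n := by positivity
    unfold tau
    push_cast
    -- Both cases express min (1, (n+1)(1-γ)) = 1 - τ_{n+1}; the additive slack absorbs the rounding
    -- of γB.
    rcases le_total 0 (1 - (n + 1 : ℝ) * (1 - γ)) with h0 | h0
    · rw [max_eq_right h0]
      refine (min_le_right _ _).trans ?_
      nlinarith
    · rw [max_eq_left h0]
      refine (min_le_left _ _).trans ?_
      linarith
  have h2 : ∀ i ∈ Finset.Ico 1 n, Finset.univ.expect
      (fun e : Placement 𝔽 (n + 1) (N + 2) B m => min (Module.finrank 𝔽 (laterKernel e i) : ℝ)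
        (m + (B - Module.finrank 𝔽 ((Finset.range i).sup (laterKernel e) :
          Submodule 𝔽 (Fin B → 𝔽))))) ≤ min (γ + tau γ i) (1 - γ) * B + 2 := by
    intro i hi
    obtain ⟨_, hi⟩ := Finset.mem_Ico.1 hi
    have h3 : Finset.univ.expect (fun e : Placement 𝔽 (n + 1) (N + 2) B m =>
        (m + (B - Module.finrank 𝔽 ((Finset.range i).sup (laterKernel e) :
          Submodule 𝔽 (Fin B → 𝔽))) : ℝ)) ≤ m + (tau γ i * B + 1) := by
      rw [Finset.expect_add_distrib, Fintype.expect_const]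
      exact add_le_add le_rfl (hu i hi.le)
    refine (expect_min_le (hl i hi) h3).trans ?_
    rw [min_mul_of_nonneg _ _ hB, ← min_add_add_right]
    refine le_min ((min_le_right _ _).trans ?_) ((min_le_left _ _).trans ?_) <;> linarith
  have h3 := Finset.sum_le_sum h2
  rw [Finset.sum_add_distrib, ← Finset.sum_mul] at h3
  simp only [Finset.sum_const, Nat.card_Ico, nsmul_eq_mul] at h3
  rw [Nat.cast_sub hn] at h3
  have h4 := hu n le_rfl
  have h5 := hl 0 hn
  have h6 : ∀ e : Placement 𝔽 (n + 1) (N + 2) B m, overlapBound e =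
      min (B : ℝ) (∑ k, (Module.finrank 𝔽 (cacheKernel e 0 k) : ℝ)) +
      Module.finrank 𝔽 (laterKernel e 0) +
      (B - Module.finrank 𝔽 ((Finset.range n).sup (laterKernel e) : Submodule 𝔽 (Fin B → 𝔽))) +
      ∑ i ∈ Finset.Ico 1 n, min (Module.finrank 𝔽 (laterKernel e i) : ℝ)
        (m + (B - Module.finrank 𝔽 ((Finset.range i).sup (laterKernel e) :
          Submodule 𝔽 (Fin B → 𝔽)))) + (m - 2 * B) := by
    intro e
    unfold overlapBound
    ring
  simp_rw [h6]
  rw [Finset.expect_add_distrib, Finset.expect_add_distrib, Finset.expect_add_distrib,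
    Finset.expect_add_distrib, Finset.expect_sum_comm, Fintype.expect_const]
  push_cast at h3
  linarith

theorem sub_overlap_le_expectedLoad {𝔽 : Type*} [Field 𝔽] [Fintype 𝔽] {n N : ℕ} (hn : 1 ≤ n)
    {γ : ℝ} (hγ₀ : 0 ≤ γ) (hγ₁ : γ ≤ 1) :
    2 * (1 - γ) -
      (tau γ n - tau γ (n + 1) + ∑ i ∈ Finset.Ico 1 n, min (γ + tau γ i) (1 - γ)) / n ≤
      expectedLoad (n + 1) (oneLinP 𝔽 (N + 2) γ) := by
  have hn0 : (0 : ℝ) < n := by exact_mod_cast hn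
  have hε : (0 : ℝ) < 1 / (2 * (n + 1 : ℕ)) := by positivity
  -- The 1 is the symbol lost to the good set; the quotient is the additive error of
  -- `expect_overlapBound_le`, divided among the n users.
  refine le_expectedLoad_oneLinP (c := 1 + (4 * n + 4) / n) hε fun B hB => ?_
  have hB0 : (0 : ℝ) < B := by exact_mod_cast hB
  set m := ⌊γ * B⌋₊ with hmdef
  have hm : (m : ℝ) ≤ γ * B := Nat.floor_le (by positivity)
  have hm' : γ * B ≤ m + 1 := (Nat.lt_floor_add_one _).le
  have hmB : m ≤ B := by
    have : (m : ℝ) ≤ B := hm.trans (by nlinarith)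
    exact_mod_cast this
  rw [meanLoad_oneLinP]
  have h1 : ∀ e : Placement 𝔽 (n + 1) (N + 2) B m,
      (2 * B - 2 * m - 1) / B + overlapBound e * (-(1 / (n * B))) ≤
        minLoad (1 / (2 * (n + 1 : ℕ))) fun k => Matrix.blockDiagonal (e k) := by
    intro e
    refine le_trans (le_of_eq ?_) (div_le_minLoad (x := 2 * B - 2 * m - 1 - overlapBound e / n)
      hε hB (fun k => Matrix.blockDiagonal (e k)) fun L S hS => ?_)
    · field_simp
      ring
    · have := mul_sub_overlapBound_le hn e S hS
      rw [sub_le_comm, le_div_iff₀ hn0]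
      linarith
  refine le_trans ?_ (Finset.expect_le_expect fun e _ => h1 e)
  rw [Finset.expect_add_distrib, Fintype.expect_const, ← Finset.expect_mul]
  have h2 := mul_le_mul_of_nonpos_right
    (expect_overlapBound_le (𝔽 := 𝔽) (N := N) hn hm hm' hmB)
    (by simp only [Left.neg_nonpos_iff]; positivity : -(1 / (n * B : ℝ)) ≤ 0)
  refine le_trans ?_ (add_le_add le_rfl h2)
  set A := tau γ n - tau γ (n + 1) + ∑ i ∈ Finset.Ico 1 n, min (γ + tau γ i) (1 - γ)
  have h3 : 2 * (1 - γ) - 1 / B ≤ (2 * B - 2 * m - 1 : ℝ) / B := by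
    rw [le_div_iff₀ hB0, sub_mul, one_div_mul_cancel hB0.ne']
    linarith
  have h4 : (A * B + (4 * n + 4)) * -(1 / (n * B : ℝ)) =
      -(A / n) - ((4 * n + 4) / n) / B := by
    field_simp
    ring
  rw [h4, add_div 1]
  linarith

/-! ### Comparison of the closed forms and conclusion -/

/-- Here jγ ≥ 1 for j ≥ 3, so every file beyond the second contributes (1-γ) - (1-γ) = 0. -/
theorem delta₂_le_of_third_le {N K : ℕ} (hK : 3 ≤ K) (hN : 2 ≤ N) {γ : ℝ} (hγ : 1 / 3 ≤ γ) :
    delta₂ N K γ ≤ 2 * (1 - γ) - (tau γ (K - 1) - tau γ K +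
      ∑ i ∈ Finset.Ico 1 (K - 1), min (γ + tau γ i) (1 - γ)) / ((K : ℝ) - 1) := by
  have h1 : ∑ j ∈ Finset.Icc 3 (min N K), (rho γ j - γ) =
      ((min N K : ℕ) - 2 : ℝ) * (1 - γ) := by
    have h2 : ∀ j ∈ Finset.Icc 3 (min N K), rho γ j - γ = 1 - γ := by
      intro j hj
      have hj3 : (3 : ℝ) ≤ j := by exact_mod_cast (Finset.mem_Icc.1 hj).1
      rw [rho, min_eq_right (by nlinarith)]
    have h3 : 2 ≤ min N K := le_min hN (by omega)
    rw [Finset.sum_congr rfl h2, Finset.sum_const, Nat.card_Icc, nsmul_eq_mul,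
      show min N K + 1 - 3 = min N K - 2 by omega, Nat.cast_sub h3]
    norm_num
  have h2 : ∑ j ∈ Finset.Icc 3 K, min (γ + tau γ (j - 2)) (1 - γ) / ((K : ℝ) - 1) =
      (∑ i ∈ Finset.Ico 1 (K - 1), min (γ + tau γ i) (1 - γ)) / ((K : ℝ) - 1) := by
    rw [Finset.sum_div]
    have := Finset.sum_Ico_add' (fun j => min (γ + tau γ (j - 2)) (1 - γ) / ((K : ℝ) - 1))
      1 (K - 1) 2
    simp only [Nat.add_sub_cancel] at this
    rw [this]
    refine Finset.sum_congr ?_ fun _ _ => rfl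
    ext j
    simp only [Finset.mem_Icc, Finset.mem_Ico]
    omega
  rw [delta₂, h1, h2, add_div]
  linarith

/-- Because ρ_j - γ = (1-γ) - [1-jγ]⁺, the first and third terms of Δ₂ add up to Δ₁ + γ. The last
sum is at least γ: its term j = 3 is 2γ/(K-1), and each of the other K - 3 terms is at least
γ/(K-1). -/
theorem delta₂_le_delta₁ {N K : ℕ} (hK : 3 ≤ K) (hN : 2 ≤ N) {γ : ℝ} (hγ₀ : 0 ≤ γ)
    (hγ : γ ≤ 1 / 3) : delta₂ N K γ ≤ delta₁ N K γ := by
  have hK0 : (0 : ℝ) < (K : ℝ) - 1 := by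
    have : (3 : ℝ) ≤ K := by exact_mod_cast hK
    linarith
  have hr : 2 ≤ min N K := le_min hN (by omega)
  have h1 : delta₁ N K γ = (1 - γ) + ((1 - 2 * γ) +
      ∑ j ∈ Finset.Icc 3 (min N K), max 0 (1 - j * γ)) := by
    rw [delta₁, Finset.Icc_eq_cons_Ioc (by omega), Finset.sum_cons,
      ← Finset.Icc_add_one_left_eq_Ioc, Finset.Icc_eq_cons_Ioc (by omega), Finset.sum_cons,
      ← Finset.Icc_add_one_left_eq_Ioc]
    norm_num
    rw [max_eq_right (by linarith), max_eq_right (by linarith)]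
  have h2 : ∑ j ∈ Finset.Icc 3 (min N K), (rho γ j - γ) =
      ((min N K : ℕ) - 2 : ℝ) * (1 - γ) -
        ∑ j ∈ Finset.Icc 3 (min N K), max 0 (1 - j * γ) := by
    have h3 : ∀ j ∈ Finset.Icc 3 (min N K), rho γ j - γ = (1 - γ) - max 0 (1 - j * γ) := by
      intro j _
      rw [rho]
      rcases le_total (j * γ) 1 with h | h
      · rw [min_eq_left h, max_eq_right (by linarith)]; ring
      · rw [min_eq_right h, max_eq_left (by linarith)]; ring
    rw [Finset.sum_congr rfl h3, Finset.sum_sub_distrib, Finset.sum_const, Nat.card_Icc,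
      nsmul_eq_mul, show min N K + 1 - 3 = min N K - 2 by omega, Nat.cast_sub hr]
    norm_num
  have h3 : tau γ K ≤ tau γ (K - 1) := by
    refine max_le_max le_rfl ?_
    rw [Nat.cast_sub (by omega)]
    push_cast
    nlinarith
  have h4 : γ ≤ ∑ j ∈ Finset.Icc 3 K, min (γ + tau γ (j - 2)) (1 - γ) / ((K : ℝ) - 1) := by
    rw [← Finset.sum_div, le_div_iff₀ hK0, Finset.Icc_eq_cons_Ioc hK, Finset.sum_cons]
    have h5 : min (γ + tau γ (3 - 2)) (1 - γ) = 2 * γ := by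
      have : tau γ (3 - 2) = γ := by
        norm_num [tau]; exact hγ₀
      rw [this, min_eq_left (by linarith)]
      ring
    have h6 : ∑ _j ∈ Finset.Ioc 3 K, γ ≤
        ∑ j ∈ Finset.Ioc 3 K, min (γ + tau γ (j - 2)) (1 - γ) :=
      Finset.sum_le_sum fun j _ =>
        le_min (le_add_of_nonneg_right (le_max_left _ _)) (by linarith)
    rw [Finset.sum_const, Nat.card_Ioc, nsmul_eq_mul, Nat.cast_sub hK] at h6
    push_cast at h6
    rw [h5]
    linarith
  have h5 : 0 ≤ (tau γ (K - 1) - tau γ K) / ((K : ℝ) - 1) :=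
    div_nonneg (by linarith) hK0.le
  rw [h1, delta₂, h2]
  linarith

end CodedCaching

theorem mainTheorem2 {𝔽 : Type*} [Field 𝔽] [Fintype 𝔽] (N K : ℕ) (hN : 1 ≤ N) (hK : 1 ≤ K)
    (γ : ℝ) (hγ₀ : 0 ≤ γ) (hγ₁ : γ ≤ 1) :
    CodedCaching.delta₁ N K γ ≤
        CodedCaching.expectedLoad K (CodedCaching.oneLinP 𝔽 N γ) ∧
      (3 ≤ K → 2 ≤ N →
        CodedCaching.delta₂ N K γ ≤
          CodedCaching.expectedLoad K (CodedCaching.oneLinP 𝔽 N γ)) := by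
  have h₁ := CodedCaching.delta₁_le_expectedLoad (𝔽 := 𝔽) hN hK hγ₀
  refine ⟨h₁, fun hK3 hN2 => ?_⟩
  rcases le_total γ (1 / 3) with hγ | hγ
  · exact (CodedCaching.delta₂_le_delta₁ hK3 hN2 hγ₀ hγ).trans h₁
  · refine (CodedCaching.delta₂_le_of_third_le hK3 hN2 hγ).trans ?_
    obtain ⟨n, rfl⟩ := Nat.exists_eq_add_of_le' hK
    obtain ⟨N', rfl⟩ := Nat.exists_eq_add_of_le' hN2
    have h := CodedCaching.sub_overlap_le_expectedLoad (𝔽 := 𝔽) (N := N') (n := n) (by omega)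
      hγ₀ hγ₁
    simpa using h
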